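/- Let $F$ be an algebraically closed field of characteristic zero. A $\ast$-superalgebra is an associative $F$-algebra $R=R_0\oplus R_1$ with $R_iR_j\subseteq R_{i+j}$ ($i,j\in\mathbb Z_2$) and an $F$-linear involution $\ast$ with $R_i^\ast\subseteq R_i$; put $R_i^{\pm}=\{a\in R_i : a^\ast=\pm a\}$. For $n\ge 1$ let $Cap_n[T,X]=\sum_{\sigma\in S_n}(\mathrm{sgn}\,\sigma)\,t_{\sigma(1)}x_1t_{\sigma(2)}\cdots x_{n-1}t_{\sigma(n)}$. We say that $Cap_n^{(\mathbb Z_2,\ast)}[Y^+,X]$ (respectively $[Y^-,X]$, $[Z^+,X]$, $[Z^-,X]$) lies in $Id^\ast_{\mathbb Z_2}(R)$ if $Cap_n$ vanishes whenever all $t_i$ are replaced by elements of $R_0^+$ (respectively $R_0^-$, $R_1^+$, $R_1^-$) and each $x_j$ by any element of $R_0^+\cup R_0^-\cup R_1^+\cup R_1^-$. *Simple $\ast$-superalgebras.* Let $M_{h,l}$ ($h\ge l\ge 0$, $h\ne 0$) be $M_{h+l}(F)$ with the grading whose even part consists of the block-diagonal matrices with blocks of sizes $h,l$, and let $M_n+cM_n=M_n(F\oplus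 cF)$, $c^2=1$, $n\ge1$, with grading $(M_n,cM_n)$. The finite dimensional simple $\ast$-superalgebras are taken from the list: (1) $M_{h,l}$ with a graded involution $\diamond$; (2) $M_{h,l}\oplus M_{h,l}^{op}$ with the exchange involution; (3), (4) $M_n+cM_n$ with $(a+cb)^\ast=a^\diamond-cb^\diamond$, respectively $(a+cb)^\ast=a^\diamond+cb^\diamond$, for an involution $\diamond$ of $M_n$; (5) $(M_n+cM_n)\oplus(M_n+cM_n)^{op}$ with the exchange involution. The size of such an algebra is $s=h+l$ in cases (1), (2) and $s=2n$ in cases (3)–(5). Let $c\mapsto\bar c\in M_s(F)$ be the inclusion in case (1), $a+cb\mapsto\begin{pmatrix}a&b\\b&a\end{pmatrix}$ in cases (3), (4), and the first projection followed by the corresponding map in cases (2), (5). Let $\alpha:\{1,\dots,s\}\to\mathbb Z_2$ be $0$ on the first $h$ (respectively $n$) positions and $1$ on the others. *The algebra $UT^\ast$.* Let $A_1,\dots,A_m$ be such algebras, with sizes $s_k$ and maps $\alpha_k$, let $\eta=s_1+\dots+s_m$, and let $\gamma$ denote the reflection of square matrices along the secondary diagonal. Then $UT^\ast(A_1,\dots,A_m)\subseteq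 M_{2\eta}(F)$ is $D\oplus V$, where $D$ consists of the block diagonal matrices $\mathrm{diag}\big(\bar c_1,\dots,\bar c_m,(\overline{c_m^\ast})^{\gamma},\dots,(\overline{c_1^\ast})^{\gamma}\big)$ with $c_k\in A_k$, and $V$ consists of the matrices $\begin{pmatrix}U&0\\0&W\end{pmatrix}$ with $U$ and $W$ of size $\eta$ and strictly block upper triangular for the block sizes $(s_1,\dots,s_m)$ and $(s_m,\dots,s_1)$ respectively. Its involution is $\gamma$. For $\tilde g=(g_1,\dots,g_m)\in\mathbb Z_2^m$ let $UT^\ast_{\mathbb Z_2,\tilde g}(A_1,\dots,A_m)$ be this algebra with the elementary grading in which $e_{p,q}$ has degree $\alpha_{\tilde g}(q)-\alpha_{\tilde g}(p)$, where $\alpha_{\tilde g}(p)=\alpha_{\tilde g}(2\eta+1-p)=\alpha_k(i)+g_k$ if $p\le\eta$ is the $i$-th position of the $k$-th block. **Lemma.** Let $A=UT^\ast_{\mathbb Z_2,\tilde g}(A_1,\dots,A_m)$, and let $d_i^{\pm}=\sum_{k}\dim_F (A_k)_i^{\pm}$ for $i=0,1$. Let $\bar m$ be the number of $A_k$ with trivial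 grading and $\tilde m$ the number of maximal strings of consecutive $A_k$ with trivial grading. Let $r_0$ (respectively $r_1$) be the number of $k<m$ such that $A_k$ and $A_{k+1}$ both have trivial grading and $g_k=g_{k+1}$ (respectively $g_k\ne g_{k+1}$). Let $q^+,q^-,k^+,k^-\ge1$ be integers. 1. If $\bar m=0$, then $Cap_{q^+}^{(\mathbb Z_2,\ast)}[Y^+,X]$, $Cap_{q^-}^{(\mathbb Z_2,\ast)}[Y^-,X]$, $Cap_{k^+}^{(\mathbb Z_2,\ast)}[Z^+,X]$ and $Cap_{k^-}^{(\mathbb Z_2,\ast)}[Z^-,X]$ are all in $Id^\ast_{\mathbb Z_2}(A)$ if and only if $q^+\ge d_0^++m$, $q^-\ge d_0^-+m$, $k^+\ge d_1^++m$ and $k^-\ge d_1^-+m$. 2. If $0<\bar m\le m$, then $r_0+r_1=\bar m-\tilde m$. Suppose moreover that there is no $1<j<m$ such that $A_{j-1},A_j,A_{j+1}$ have trivial grading, $\dim_F A_j=1$, and $g_{j-1}=g_{j+1}\ne g_j$. Then the same four polynomials are all in $Id^\ast_{\mathbb Z_2}(A)$ if and only if $$q^\pm> d_0^\pm+(m-\bar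 m)+(\tilde m-1)+r_0\quad\text{and}\quad k^\pm> d_1^\pm+(m-\bar m)+(\tilde m-1)+r_1 .$$ Without that supposition it still holds that each of the polynomials $Cap_{q^+}^{(\mathbb Z_2,\ast)}[Y^+,X]$, $Cap_{k^+}^{(\mathbb Z_2,\ast)}[Z^+,X]$, $Cap_{k^-}^{(\mathbb Z_2,\ast)}[Z^-,X]$ is in $Id^\ast_{\mathbb Z_2}(A)$ if and only if the corresponding inequality holds, and that $Cap_{q^-}^{(\mathbb Z_2,\ast)}[Y^-,X]\in Id^\ast_{\mathbb Z_2}(A)$ implies $q^->d_0^-+(m-\bar m)+(\tilde m-1)+r_0$. -/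

import Mathlib

universe u v

/-! ### Superalgebras with graded involution -/

/-- An (`F`-linear) involution of an `F`-algebra: a linear antiautomorphism of order at most two. -/
structure AlgInvolution (F : Type u) (R : Type v) [Field F] [Ring R] [Algebra F R] where
  toLin : R →ₗ[F] R
  map_mul' : ∀ a b, toLin (a * b) = toLin b * toLin a
  invol : ∀ a, toLin (toLin a) = a

/-- A superalgebra structure on an `F`-algebra `R`: a decomposition `R = R₀ ⊕ R₁` with
`Rᵢ Rⱼ ⊆ Rᵢ₊ⱼ`. -/
structure Superalg (F : Type u) (R : Type v) [Field F] [Ring R] [Algebra F R] where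
  comp : ZMod 2 → Submodule F R
  isCompl : IsCompl (comp 0) (comp 1)
  mul_mem : ∀ {i j a b}, a ∈ comp i → b ∈ comp j → a * b ∈ comp (i + j)

/-- A `∗`-superalgebra structure on `R`: a superalgebra with an involution that preserves the
homogeneous components. -/
structure StarSuperalg (F : Type u) (R : Type v) [Field F] [Ring R] [Algebra F R]
    extends Superalg F R where
  inv : AlgInvolution F R
  inv_mem : ∀ {i a}, a ∈ comp i → inv.toLin a ∈ comp i

/-- The four kinds of variables `y⁺, y⁻, z⁺, z⁻` of the free `∗`-superalgebra. -/
inductive VarKind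
  | evenSym
  | evenSkew
  | oddSym
  | oddSkew

namespace StarSuperalg

variable {F : Type u} {R : Type v} [Field F] [Ring R] [Algebra F R]

/-- The homogeneous symmetric elements of degree `i`. -/
def symPart (S : StarSuperalg F R) (i : ZMod 2) : Submodule F R :=
  S.comp i ⊓ LinearMap.ker (S.inv.toLin - LinearMap.id)

/-- The homogeneous skew elements of degree `i`. -/
def skewPart (S : StarSuperalg F R) (i : ZMod 2) : Submodule F R :=
  S.comp i ⊓ LinearMap.ker (S.inv.toLin + LinearMap.id)

/-- The elements that may be substituted for a variable of the given kind:
`R₀⁺, R₀⁻, R₁⁺, R₁⁻`. -/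
def part (S : StarSuperalg F R) : VarKind → Submodule F R
  | .evenSym => S.symPart 0
  | .evenSkew => S.skewPart 0
  | .oddSym => S.symPart 1
  | .oddSkew => S.skewPart 1

theorem mem_symPart (S : StarSuperalg F R) (i : ZMod 2) (a : R) :
    a ∈ S.symPart i ↔ a ∈ S.comp i ∧ S.inv.toLin a = a := by
  simp [symPart, sub_eq_zero]

theorem mem_skewPart (S : StarSuperalg F R) (i : ZMod 2) (a : R) :
    a ∈ S.skewPart i ↔ a ∈ S.comp i ∧ S.inv.toLin a = -a := by
  simp [skewPart, add_eq_zero_iff_eq_neg]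

/-- The set of `∗`-graded polynomial identities of `R`. The free `∗`-superalgebra is, as an
algebra, freely generated by the variables `yᵢ⁺, yᵢ⁻, zᵢ⁺, zᵢ⁻`, that is, by `VarKind × ℕ`. -/
def identities (S : StarSuperalg F R) : Set (FreeAlgebra F (VarKind × ℕ)) :=
  {f | ∀ φ : VarKind × ℕ → R, (∀ v, φ v ∈ S.part v.1) → FreeAlgebra.lift F φ f = 0}

end StarSuperalg

/-! ### Capelli polynomials -/

/-- `Capₙ(t₁, …, tₙ; x₁, …, xₙ₋₁) = ∑ sgn(σ) t_σ(1) x₁ t_σ(2) ⋯ xₙ₋₁ t_σ(n)`, with indices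
starting from `0`. -/
def capelli {R : Type v} [Ring R] (n : ℕ) (t x : ℕ → R) : R :=
  ∑ σ : Equiv.Perm (Fin n), (Equiv.Perm.sign σ : ℤ) •
    (List.ofFn fun i : Fin n => t (σ i) * if (i : ℕ) + 1 < n then x i else 1).prod

/-- The `n`-th `∗`-graded Capelli polynomial, alternating in the variables of kind `κ` with indices
`0, …, n - 1`. The variables `x₁, …, xₙ₋₁` are arbitrary further variables, so this is the family
of the polynomials obtained from all choices of the kinds `ε j` of the `xⱼ`. -/
def gradedCapelli (F : Type u) [Field F] (κ : VarKind) (n : ℕ) :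
    Set (FreeAlgebra F (VarKind × ℕ)) :=
  Set.range fun ε : ℕ → VarKind =>
    capelli n (fun i => FreeAlgebra.ι F (κ, i)) (fun j => FreeAlgebra.ι F (ε j, n + j))

/-! ### Elementary gradings of matrix algebras -/

section Matrices

variable {F : Type u} [Field F] {ι : Type} [Fintype ι] [DecidableEq ι]

theorem zmod_two_eq_zero_or_one (x : ZMod 2) : x = 0 ∨ x = 1 := by
  revert x; decide

theorem zmod_two_add_self (x : ZMod 2) : x + x = 0 := by
  revert x; decide

/-- The elementary grading induced by `α`: the matrix unit `e_{p,q}` has degree `α p + α q`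
(which is `α q - α p` in `ℤ/2`). -/
def elementaryGrading (α : ι → ZMod 2) : Superalg F (Matrix ι ι F) where
  comp i :=
    { carrier := {X | ∀ p q, α p + α q ≠ i → X p q = 0}
      add_mem' := fun {X Y} hX hY p q h => by simp [hX p q h, hY p q h]
      zero_mem' := fun p q _ => rfl
      smul_mem' := fun c X hX p q h => by simp [hX p q h] }
  isCompl := by
    refine ⟨Submodule.disjoint_def.2 fun X h0 h1 => ?_, codisjoint_iff_le_sup.2 fun X _ => ?_⟩
    · ext p q
      rcases zmod_two_eq_zero_or_one (α p + α q) with h | h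
      · exact h1 p q (by rw [h]; decide)
      · exact h0 p q (by rw [h]; decide)
    · refine Submodule.mem_sup.2 ⟨Matrix.of fun p q => if α p + α q = 0 then X p q else 0,
        fun p q h => if_neg h, Matrix.of fun p q => if α p + α q = 1 then X p q else 0,
        fun p q h => if_neg h, ?_⟩
      ext p q
      rcases zmod_two_eq_zero_or_one (α p + α q) with h | h <;> simp [h]
  mul_mem := by
    intro i j X Y hX hY p q h
    rw [Matrix.mul_apply]
    refine Finset.sum_eq_zero fun r _ => ?_
    by_cases h1 : α p + α r = i
    · by_cases h2 : α r + α q = j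
      · refine absurd ?_ h
        have := zmod_two_add_self (α r)
        rw [← h1, ← h2]
        linear_combination -this
      · rw [hY r q h2, mul_zero]
    · rw [hX p r h1, zero_mul]

end Matrices

/-! ### The finite dimensional simple `∗`-superalgebras -/

/-- The degrees of the rows of `M_{h,l}`. -/
def blockDeg (h l : ℕ) : Fin h ⊕ Fin l → ZMod 2 := Sum.elim (fun _ => 0) (fun _ => 1)

/-- `M_{h+l}(F)`, the underlying algebra of `M_{h,l}`. -/
abbrev MHL (F : Type u) (h l : ℕ) : Type u := Matrix (Fin h ⊕ Fin l) (Fin h ⊕ Fin l) F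

/-- `M_n + cM_n = M_n(F ⊕ cF)` with `c² = 1`. -/
abbrev MC (F : Type u) [Field F] (n : ℕ) : Type u :=
  Matrix (Fin n) (Fin n) (QuadraticAlgebra F 1 0)

/-- The grading of `M_{h,l}`. -/
abbrev gradingHL (F : Type u) [Field F] (h l : ℕ) : Superalg F (MHL F h l) :=
  elementaryGrading (blockDeg h l)

/-- The finite dimensional simple `∗`-superalgebras over an algebraically closed field of
characteristic zero, as a list of five families:
* `mat`: `(M_{h,l}, ⋄)`, with any graded involution `⋄` (such as the transpose or, where it exists,
  the symplectic one);
* `matExc`: `(M_{h,l} ⊕ M_{h,l}ᵒᵖ, exc)`;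
* `cStar`: `(M_n + cM_n, ⋆)`, `(a + cb)⋆ = a^⋄ - c b^⋄`, with any involution `⋄` of `M_n`;
* `cDagger`: `(M_n + cM_n, †)`, `(a + cb)† = a^⋄ + c b^⋄`, with any involution `⋄` of `M_n`;
* `cExc`: `((M_n + cM_n) ⊕ (M_n + cM_n)ᵒᵖ, exc)`. -/
inductive SimpleStar (F : Type u) [Field F] : Type u
  | mat (h l : ℕ) (hl : l ≤ h) (hh : h ≠ 0) (d : AlgInvolution F (MHL F h l))
      (hd : ∀ {i X}, X ∈ (gradingHL F h l).comp i → d.toLin X ∈ (gradingHL F h l).comp i)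
  | matExc (h l : ℕ) (hl : l ≤ h) (hh : h ≠ 0)
  | cStar (n : ℕ) (hn : n ≠ 0) (d : AlgInvolution F (Matrix (Fin n) (Fin n) F))
  | cDagger (n : ℕ) (hn : n ≠ 0) (d : AlgInvolution F (Matrix (Fin n) (Fin n) F))
  | cExc (n : ℕ) (hn : n ≠ 0)

section MC

variable {F : Type u} [Field F] {n : ℕ}

/-- The map `a + cb ↦ a`. -/
def MC.re : MC F n →ₗ[F] Matrix (Fin n) (Fin n) F where
  toFun X := Matrix.of fun p q => (X p q).re
  map_add' _ _ := rfl
  map_smul' _ _ := rfl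

/-- The map `a + cb ↦ b`. -/
def MC.im : MC F n →ₗ[F] Matrix (Fin n) (Fin n) F where
  toFun X := Matrix.of fun p q => (X p q).im
  map_add' _ _ := rfl
  map_smul' _ _ := rfl

theorem MC.re_apply (X : MC F n) (p q : Fin n) : MC.re X p q = (X p q).re := rfl

theorem MC.im_apply (X : MC F n) (p q : Fin n) : MC.im X p q = (X p q).im := rfl

/-- The element `a + cb` of `M_n + cM_n`. -/
def MC.mk (a b : Matrix (Fin n) (Fin n) F) : MC F n := Matrix.of fun p q => ⟨a p q, b p q⟩

@[simp] theorem MC.re_mk (a b : Matrix (Fin n) (Fin n) F) : MC.re (MC.mk a b) = a := rfl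

@[simp] theorem MC.im_mk (a b : Matrix (Fin n) (Fin n) F) : MC.im (MC.mk a b) = b := rfl

theorem MC.ext' {X Y : MC F n} (h0 : MC.re X = MC.re Y) (h1 : MC.im X = MC.im Y) : X = Y := by
  ext p q
  · exact congrFun (congrFun h0 p) q
  · exact congrFun (congrFun h1 p) q

theorem MC.re_sum {s : Finset (Fin n)} (f : Fin n → QuadraticAlgebra F 1 0) :
    (∑ i ∈ s, f i).re = ∑ i ∈ s, (f i).re := by
  classical
  induction s using Finset.induction_on with
  | empty => rfl
  | insert a s ha ih => simp [Finset.sum_insert ha, ih]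

theorem MC.im_sum {s : Finset (Fin n)} (f : Fin n → QuadraticAlgebra F 1 0) :
    (∑ i ∈ s, f i).im = ∑ i ∈ s, (f i).im := by
  classical
  induction s using Finset.induction_on with
  | empty => rfl
  | insert a s ha ih => simp [Finset.sum_insert ha, ih]

theorem MC.re_mul (X Y : MC F n) :
    MC.re (X * Y) = MC.re X * MC.re Y + MC.im X * MC.im Y := by
  ext p q
  simp [MC.re_apply, MC.im_apply, Matrix.mul_apply, MC.re_sum, Finset.sum_add_distrib]

theorem MC.im_mul (X Y : MC F n) :
    MC.im (X * Y) = MC.re X * MC.im Y + MC.im X * MC.re Y := by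
  ext p q
  simp [MC.re_apply, MC.im_apply, Matrix.mul_apply, MC.im_sum, Finset.sum_add_distrib]

theorem MC.re_one : MC.re (1 : MC F n) = 1 := by
  ext p q
  by_cases h : p = q <;> simp [MC.re_apply, h, Matrix.one_apply, QuadraticAlgebra.re_one]

theorem MC.im_one : MC.im (1 : MC F n) = 0 := by
  ext p q
  by_cases h : p = q <;> simp [MC.im_apply, h, QuadraticAlgebra.im_one]

/-- The grading `(M_n, cM_n)` of `M_n + cM_n`. -/
def gradingMC (F : Type u) [Field F] (n : ℕ) : Superalg F (MC F n) where
  comp i := if i = 0 then LinearMap.ker MC.im else LinearMap.ker MC.re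
  isCompl := by
    simp only [if_true, if_neg (show (1 : ZMod 2) ≠ 0 by decide)]
    refine ⟨Submodule.disjoint_def.2 fun X h0 h1 => ?_, codisjoint_iff_le_sup.2 fun X _ => ?_⟩
    · rw [LinearMap.mem_ker] at h0 h1
      exact MC.ext' (by simp [h1]) (by simp [h0])
    · exact Submodule.mem_sup.2 ⟨MC.mk (MC.re X) 0, by simp, MC.mk 0 (MC.im X), by simp,
        MC.ext' (by simp) (by simp)⟩
  mul_mem := by
    intro i j X Y hX hY
    rcases zmod_two_eq_zero_or_one i with rfl | rfl <;>
    rcases zmod_two_eq_zero_or_one j with rfl | rfl <;>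
    simp_all [MC.re_mul, MC.im_mul, show (1 : ZMod 2) + 1 = 0 by decide]

/-- The involution `a + cb ↦ a^⋄ + s • c b^⋄` for a sign `s`. -/
def involutionMC (d : AlgInvolution F (Matrix (Fin n) (Fin n) F)) (s : ℤˣ) :
    AlgInvolution F (MC F n) where
  toLin :=
    { toFun := fun X => MC.mk (d.toLin (MC.re X)) ((s : ℤ) • d.toLin (MC.im X))
      map_add' := fun X Y => MC.ext' (by simp) (by simp)
      map_smul' := fun r X => MC.ext' (by simp) (by simp [smul_comm]) }
  map_mul' X Y := by
    rcases Int.units_eq_one_or s with rfl | rfl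
    · exact MC.ext' (by simp [MC.re_mul, d.map_mul'])
        (by simp [MC.im_mul, d.map_mul', add_comm])
    · exact MC.ext' (by simp [MC.re_mul, d.map_mul'])
        (by simp [MC.im_mul, d.map_mul', add_comm])
  invol X := by
    rcases Int.units_eq_one_or s with rfl | rfl
    · exact MC.ext' (by simp [d.invol]) (by simp [d.invol])
    · exact MC.ext' (by simp [d.invol]) (by simp [d.invol])

/-- The `∗`-superalgebra `M_n + cM_n` with the involution `a + cb ↦ a^⋄ + s • c b^⋄`. -/
def starMC (d : AlgInvolution F (Matrix (Fin n) (Fin n) F)) (s : ℤˣ) :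
    StarSuperalg F (MC F n) where
  toSuperalg := gradingMC F n
  inv := involutionMC d s
  inv_mem := by
    intro i X hX
    rcases zmod_two_eq_zero_or_one i with rfl | rfl <;>
    simp_all [gradingMC, involutionMC]

/-- The embedding `a + cb ↦ (a b; b a)` of `M_n + cM_n` into `M_{n,n}`. -/
def MC.toMat : MC F n →ₐ[F] MHL F n n where
  toFun X := Matrix.fromBlocks (MC.re X) (MC.im X) (MC.im X) (MC.re X)
  map_one' := by simp [MC.re_one, MC.im_one]
  map_zero' := by simp
  map_add' X Y := by simp [Matrix.fromBlocks_add]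
  map_mul' X Y := by
    rw [Matrix.fromBlocks_multiply, MC.re_mul, MC.im_mul,
      add_comm (MC.im X * MC.re Y), add_comm (MC.im X * MC.im Y)]
  commutes' r := by
    rw [Algebra.algebraMap_eq_smul_one, Algebra.algebraMap_eq_smul_one, map_smul, map_smul,
      MC.re_one, MC.im_one, smul_zero, ← Matrix.fromBlocks_one, Matrix.fromBlocks_smul, smul_zero]

theorem MC.toMat_mem {i : ZMod 2} {X : MC F n} (hX : X ∈ (gradingMC F n).comp i) :
    MC.toMat X ∈ (gradingHL F n n).comp i := by
  rcases zmod_two_eq_zero_or_one i with rfl | rfl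
  · have h : MC.im X = 0 := by simpa [gradingMC] using hX
    rintro (p | p) (q | q) hpq <;>
      simp_all [MC.toMat, blockDeg, show (1 : ZMod 2) + 1 = 0 by decide]
  · have h : MC.re X = 0 := by simpa [gradingMC] using hX
    rintro (p | p) (q | q) hpq <;>
      simp_all [MC.toMat, blockDeg, show (1 : ZMod 2) + 1 = 0 by decide]

end MC

/-- The `∗`-superalgebra `(R ⊕ Rᵒᵖ, exc)` with the induced grading and the exchange involution
`(a, b) ↦ (b, a)`. -/
def exchange {F : Type u} {R : Type v} [Field F] [Ring R] [Algebra F R] (S : Superalg F R) :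
    StarSuperalg F (R × Rᵐᵒᵖ) where
  comp i :=
    { carrier := {x | x.1 ∈ S.comp i ∧ x.2.unop ∈ S.comp i}
      add_mem' := fun hx hy => ⟨add_mem hx.1 hy.1, add_mem hx.2 hy.2⟩
      zero_mem' := ⟨zero_mem _, zero_mem _⟩
      smul_mem' := fun c _ hx => ⟨Submodule.smul_mem _ c hx.1, Submodule.smul_mem _ c hx.2⟩ }
  isCompl := by
    refine ⟨Submodule.disjoint_def.2 fun x h0 h1 => ?_, codisjoint_iff_le_sup.2 fun x _ => ?_⟩
    · refine Prod.ext ?_ (MulOpposite.unop_injective ?_)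
      · exact Submodule.disjoint_def.1 S.isCompl.1 _ h0.1 h1.1
      · exact Submodule.disjoint_def.1 S.isCompl.1 _ h0.2 h1.2
    · have key : ∀ a : R, ∃ y ∈ S.comp 0, ∃ z ∈ S.comp 1, y + z = a := fun a =>
        Submodule.mem_sup.1 (codisjoint_iff_le_sup.1 S.isCompl.2 (Submodule.mem_top (x := a)))
      obtain ⟨a0, ha0, a1, ha1, ha⟩ := key x.1
      obtain ⟨b0, hb0, b1, hb1, hb⟩ := key x.2.unop
      refine Submodule.mem_sup.2 ⟨(a0, MulOpposite.op b0), ⟨ha0, hb0⟩,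
        (a1, MulOpposite.op b1), ⟨ha1, hb1⟩, Prod.ext ha (MulOpposite.unop_injective hb)⟩
  mul_mem := fun {i j} _ _ ha hb => ⟨S.mul_mem ha.1 hb.1, by
    rw [add_comm i j]; exact S.mul_mem hb.2 ha.2⟩
  inv :=
    { toLin :=
        { toFun := fun x => (x.2.unop, MulOpposite.op x.1)
          map_add' := fun _ _ => rfl
          map_smul' := fun _ _ => rfl }
      map_mul' := fun _ _ => rfl
      invol := fun _ => rfl }
  inv_mem := fun h => ⟨h.2, h.1⟩

namespace SimpleStar

variable {F : Type u} [Field F]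

/-- The number of rows of degree zero of a block. -/
def evenSize : SimpleStar F → ℕ
  | mat h _ _ _ _ _ => h
  | matExc h _ _ _ => h
  | cStar n _ _ => n
  | cDagger n _ _ => n
  | cExc n _ => n

/-- The number of rows of degree one of a block. -/
def oddSize : SimpleStar F → ℕ
  | mat _ l _ _ _ _ => l
  | matExc _ l _ _ => l
  | cStar n _ _ => n
  | cDagger n _ _ => n
  | cExc n _ => n

/-- The positions of a block; their number is its size `h + l`, respectively `2n`. -/
abbrev Idx (A : SimpleStar F) : Type := Fin A.evenSize ⊕ Fin A.oddSize

/-- The map `α_k` of the block. -/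
abbrev deg (A : SimpleStar F) : A.Idx → ZMod 2 := blockDeg A.evenSize A.oddSize

/-- The underlying algebra. -/
def Carrier : SimpleStar F → Type u
  | mat h l _ _ _ _ => MHL F h l
  | matExc h l _ _ => MHL F h l × (MHL F h l)ᵐᵒᵖ
  | cStar n _ _ => MC F n
  | cDagger n _ _ => MC F n
  | cExc n _ => MC F n × (MC F n)ᵐᵒᵖ

instance instRingCarrier : (A : SimpleStar F) → Ring A.Carrier
  | mat h l _ _ _ _ => inferInstanceAs (Ring (MHL F h l))
  | matExc h l _ _ => inferInstanceAs (Ring (MHL F h l × (MHL F h l)ᵐᵒᵖ))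
  | cStar n _ _ => inferInstanceAs (Ring (MC F n))
  | cDagger n _ _ => inferInstanceAs (Ring (MC F n))
  | cExc n _ => inferInstanceAs (Ring (MC F n × (MC F n)ᵐᵒᵖ))

instance instAlgebraCarrier : (A : SimpleStar F) → Algebra F A.Carrier
  | mat h l _ _ _ _ => inferInstanceAs (Algebra F (MHL F h l))
  | matExc h l _ _ => inferInstanceAs (Algebra F (MHL F h l × (MHL F h l)ᵐᵒᵖ))
  | cStar n _ _ => inferInstanceAs (Algebra F (MC F n))
  | cDagger n _ _ => inferInstanceAs (Algebra F (MC F n))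
  | cExc n _ => inferInstanceAs (Algebra F (MC F n × (MC F n)ᵐᵒᵖ))

/-- The grading and the involution. -/
def str : (A : SimpleStar F) → StarSuperalg F A.Carrier
  | mat h l _ _ d hd => { toSuperalg := gradingHL F h l, inv := d, inv_mem := hd }
  | matExc h l _ _ => exchange (gradingHL F h l)
  | cStar _ _ d => starMC d (-1)
  | cDagger _ _ d => starMC d 1
  | cExc n _ => exchange (gradingMC F n)

/-- The map `c ↦ ā` into the matrices of the size of the block. -/
def top : (A : SimpleStar F) → A.Carrier →ₐ[F] Matrix A.Idx A.Idx F
  | mat h l _ _ _ _ => AlgHom.id F (MHL F h l)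
  | matExc h l _ _ => AlgHom.fst F (MHL F h l) (MHL F h l)ᵐᵒᵖ
  | cStar _ _ _ => MC.toMat
  | cDagger _ _ _ => MC.toMat
  | cExc n _ => MC.toMat.comp (AlgHom.fst F (MC F n) (MC F n)ᵐᵒᵖ)

theorem top_mem (A : SimpleStar F) {i : ZMod 2} {c : A.Carrier} (hc : c ∈ A.str.comp i) :
    A.top c ∈ (elementaryGrading (F := F) A.deg).comp i := by
  cases A with
  | mat h l hl hh d hd => exact hc
  | matExc h l hl hh => exact hc.1
  | cStar n hn d => exact MC.toMat_mem hc
  | cDagger n hn d => exact MC.toMat_mem hc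
  | cExc n hn => exact MC.toMat_mem hc.1

/-- The grading is trivial: there are no nonzero elements of degree one. -/
def IsTrivial (A : SimpleStar F) : Prop := A.str.comp 1 = ⊥

/-- `(d₀⁺)ᵢ`, `(d₀⁻)ᵢ`, `(d₁⁺)ᵢ`, `(d₁⁻)ᵢ`: the dimensions of the four components. -/
noncomputable def dim (A : SimpleStar F) (κ : VarKind) : ℕ :=
  Module.finrank F (A.str.part κ)

end SimpleStar

/-! ### The `∗`-superalgebra `UT∗(A₁, …, A_m)` -/

namespace UT

variable {F : Type u} [Field F] {m : ℕ}

/-- The positions `1, …, η_m`: pairs of a block `k` and a position in the block. -/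
abbrev Half (A : Fin m → SimpleStar F) : Type := Σ k, (A k).Idx

/-- The positions `1, …, 2η_m`. If `p` is one of the first `η_m` positions, then `Sum.inl p` stands
for `p` and `Sum.inr p` for the mirror position `2η_m + 1 - p`. -/
abbrev Pos (A : Fin m → SimpleStar F) : Type := Half A ⊕ Half A

/-- The matrix algebra `M_{2η_m}(F)`. -/
abbrev Amb (A : Fin m → SimpleStar F) : Type u := Matrix (Pos A) (Pos A) F

/-- The reflection along the secondary diagonal: it sends `e_{p,q}` to `e_{q',p'}`, where `p'` is
the mirror position of `p`. -/
def gamma (A : Fin m → SimpleStar F) : AlgInvolution F (Amb A) where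
  toLin :=
    { toFun := fun X => X.transpose.submatrix Sum.swap Sum.swap
      map_add' := fun _ _ => rfl
      map_smul' := fun _ _ => rfl }
  map_mul' X Y := by
    change (X * Y).transpose.submatrix Sum.swap Sum.swap =
      Y.transpose.submatrix Sum.swap Sum.swap * X.transpose.submatrix Sum.swap Sum.swap
    rw [Matrix.transpose_mul]
    exact (Matrix.submatrix_mul_equiv _ _ _ (Equiv.sumComm (Half A) (Half A)) _).symm
  invol X := by
    change (X.transpose.submatrix Sum.swap Sum.swap).transpose.submatrix Sum.swap Sum.swap = X
    ext p q
    simp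

theorem gamma_apply (A : Fin m → SimpleStar F) (X : Amb A) (p q : Pos A) :
    (gamma A).toLin X p q = X q.swap p.swap := rfl

/-- The map `α_g̃`. -/
def alpha (A : Fin m → SimpleStar F) (g : Fin m → ZMod 2) : Pos A → ZMod 2 :=
  Sum.elim (fun p => (A p.1).deg p.2 + g p.1) (fun p => (A p.1).deg p.2 + g p.1)

/-- The position `(p, q)` lies in one of the blocks `V_{ij}`. In both halves these are strictly above
the diagonal; in the mirrored half the blocks occur in the order `m, …, 1`. -/
def InV (A : Fin m → SimpleStar F) : Pos A → Pos A → Prop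
  | Sum.inl p, Sum.inl q => p.1 < q.1
  | Sum.inr p, Sum.inr q => q.1 < p.1
  | _, _ => False

/-- The space `V`. -/
def V (A : Fin m → SimpleStar F) : Submodule F (Amb A) where
  carrier := {X | ∀ p q, ¬ InV A p q → X p q = 0}
  add_mem' := fun {X Y} hX hY p q h => by simp [hX p q h, hY p q h]
  zero_mem' := fun _ _ _ => rfl
  smul_mem' := fun c X hX p q h => by simp [hX p q h]

/-- The map `Δ : ⨁ A_k → M_{2η_m}`, `(c₁, …, c_m) ↦ diag(ā₁, …, ā_m, b̄_m, …, b̄₁)`.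

In each of the five families `b̄_k` is the reflection along the secondary diagonal of the matrix
`ā` that belongs to `c_k∗`. With rows and columns labelled by mirror positions, this reflection is
the transpose. -/
def Delta (A : Fin m → SimpleStar F) (c : ∀ k, (A k).Carrier) : Amb A :=
  Matrix.fromBlocks
    (Matrix.blockDiagonal' fun k => (A k).top (c k)) 0
    0 (Matrix.blockDiagonal' fun k => ((A k).top ((A k).str.inv.toLin (c k))).transpose)

theorem Delta_inl (A : Fin m → SimpleStar F) (c : ∀ k, (A k).Carrier) (k : Fin m)
    (p q : (A k).Idx) : Delta A c (Sum.inl ⟨k, p⟩) (Sum.inl ⟨k, q⟩) = (A k).top (c k) p q :=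
  Matrix.blockDiagonal'_apply_eq (fun k => (A k).top (c k)) k p q

theorem Delta_inr (A : Fin m → SimpleStar F) (c : ∀ k, (A k).Carrier) (k : Fin m)
    (p q : (A k).Idx) : Delta A c (Sum.inr ⟨k, p⟩) (Sum.inr ⟨k, q⟩) =
      (A k).top ((A k).str.inv.toLin (c k)) q p :=
  Matrix.blockDiagonal'_apply_eq
    (fun k => ((A k).top ((A k).str.inv.toLin (c k))).transpose) k p q

theorem inv_one {R : Type v} [Ring R] [Algebra F R] (d : AlgInvolution F R) :
    d.toLin 1 = 1 := by
  have h := d.map_mul' (d.toLin 1) 1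
  rw [mul_one, d.invol, mul_one] at h
  exact h.symm

theorem Delta_one (A : Fin m → SimpleStar F) : Delta A 1 = 1 := by
  have h : (fun k => (A k).top (1 : (A k).Carrier)) = 1 := by
    ext1 k; exact map_one _
  simp only [Delta, Pi.one_apply, inv_one, map_one, Matrix.transpose_one]
  rw [← Matrix.fromBlocks_one, ← Matrix.blockDiagonal'_one]
  rfl

theorem Delta_mul (A : Fin m → SimpleStar F) (c e : ∀ k, (A k).Carrier) :
    Delta A (c * e) = Delta A c * Delta A e := by
  simp only [Delta, Pi.mul_apply, AlgInvolution.map_mul', map_mul, Matrix.transpose_mul,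
    Matrix.blockDiagonal'_mul, Matrix.fromBlocks_multiply, mul_zero, zero_mul, add_zero, zero_add]

theorem Delta_add (A : Fin m → SimpleStar F) (c e : ∀ k, (A k).Carrier) :
    Delta A (c + e) = Delta A c + Delta A e := by
  simp only [Delta, Pi.add_apply, map_add, Matrix.transpose_add, Matrix.fromBlocks_add, add_zero]
  rw [← Matrix.blockDiagonal'_add, ← Matrix.blockDiagonal'_add]
  rfl

theorem Delta_smul (A : Fin m → SimpleStar F) (r : F) (c : ∀ k, (A k).Carrier) :
    Delta A (r • c) = r • Delta A c := by
  simp only [Delta, Pi.smul_apply, map_smul, Matrix.transpose_smul, Matrix.fromBlocks_smul,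
    smul_zero]
  rw [← Matrix.blockDiagonal'_smul, ← Matrix.blockDiagonal'_smul]
  rfl

theorem InV.trans {A : Fin m → SimpleStar F} {p q r : Pos A} (h1 : InV A p q) (h2 : InV A q r) :
    InV A p r := by
  rcases p with p | p <;> rcases q with q | q <;> rcases r with r | r <;>
    simp_all only [InV]
  · exact lt_trans h1 h2
  · exact lt_trans h2 h1

/-- `p` and `q` lie in the same diagonal block. -/
def SameBlock (A : Fin m → SimpleStar F) : Pos A → Pos A → Prop
  | Sum.inl p, Sum.inl q => p.1 = q.1
  | Sum.inr p, Sum.inr q => p.1 = q.1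
  | _, _ => False

theorem Delta_apply_of_not {A : Fin m → SimpleStar F} (c : ∀ k, (A k).Carrier) {p q : Pos A}
    (h : ¬ SameBlock A p q) : Delta A c p q = 0 := by
  rcases p with ⟨k, p⟩ | ⟨k, p⟩ <;> rcases q with ⟨l, q⟩ | ⟨l, q⟩
  · exact Matrix.blockDiagonal'_apply_ne (fun k => (A k).top (c k)) _ _ h
  · rfl
  · rfl
  · exact Matrix.blockDiagonal'_apply_ne
      (fun k => ((A k).top ((A k).str.inv.toLin (c k))).transpose) _ _ h

theorem V_mul {A : Fin m → SimpleStar F} {X Y : Amb A} (hX : X ∈ V A) (hY : Y ∈ V A) :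
    X * Y ∈ V A := by
  intro p q h
  rw [Matrix.mul_apply]
  refine Finset.sum_eq_zero fun r _ => ?_
  by_cases h1 : InV A p r
  · by_cases h2 : InV A r q
    · exact absurd (h1.trans h2) h
    · rw [hY r q h2, mul_zero]
  · rw [hX p r h1, zero_mul]

theorem Delta_mul_V {A : Fin m → SimpleStar F} (c : ∀ k, (A k).Carrier) {Y : Amb A}
    (hY : Y ∈ V A) : Delta A c * Y ∈ V A := by
  intro p q h
  rw [Matrix.mul_apply]
  refine Finset.sum_eq_zero fun r _ => ?_
  by_cases h1 : SameBlock A p r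
  · by_cases h2 : InV A r q
    · refine absurd ?_ h
      rcases p with p | p <;> rcases q with q | q <;> rcases r with r | r <;>
        simp_all only [InV, SameBlock]
    · rw [hY r q h2, mul_zero]
  · rw [Delta_apply_of_not c h1, zero_mul]

theorem V_mul_Delta {A : Fin m → SimpleStar F} (c : ∀ k, (A k).Carrier) {Y : Amb A}
    (hY : Y ∈ V A) : Y * Delta A c ∈ V A := by
  intro p q h
  rw [Matrix.mul_apply]
  refine Finset.sum_eq_zero fun r _ => ?_
  by_cases h1 : SameBlock A r q
  · by_cases h2 : InV A p r
    · refine absurd ?_ h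
      rcases p with p | p <;> rcases q with q | q <;> rcases r with r | r <;>
        simp_all only [InV, SameBlock]
    · rw [hY p r h2, zero_mul]
  · rw [Delta_apply_of_not c h1, mul_zero]

/-- The algebra `UT∗(A₁, …, A_m) = D ⊕ V`, where `D` is the image of `Δ`. -/
def alg (A : Fin m → SimpleStar F) : Subalgebra F (Amb A) where
  carrier := {X | ∃ c, ∃ v ∈ V A, X = Delta A c + v}
  mul_mem' := by
    rintro _ _ ⟨c, v, hv, rfl⟩ ⟨e, w, hw, rfl⟩
    refine ⟨c * e, Delta A c * w + v * Delta A e + v * w,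
      add_mem (add_mem (Delta_mul_V c hw) (V_mul_Delta e hv)) (V_mul hv hw), ?_⟩
    rw [Delta_mul]
    noncomm_ring
  add_mem' := by
    rintro _ _ ⟨c, v, hv, rfl⟩ ⟨e, w, hw, rfl⟩
    exact ⟨c + e, v + w, add_mem hv hw, by rw [Delta_add]; abel⟩
  algebraMap_mem' r := by
    refine ⟨r • 1, 0, zero_mem _, ?_⟩
    rw [Delta_smul, Delta_one, Algebra.algebraMap_eq_smul_one, add_zero]

theorem gamma_Delta (A : Fin m → SimpleStar F) (c : ∀ k, (A k).Carrier) :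
    (gamma A).toLin (Delta A c) = Delta A fun k => (A k).str.inv.toLin (c k) := by
  ext p q
  rcases p with ⟨k, p⟩ | ⟨k, p⟩ <;> rcases q with ⟨l, q⟩ | ⟨l, q⟩
  · rw [gamma_apply]
    by_cases h : k = l
    · subst h
      simp only [Sum.swap_inl, Delta_inl, Delta_inr]
    · have h' : ¬ SameBlock A (Sum.inr ⟨l, q⟩) (Sum.inr ⟨k, p⟩) := Ne.symm h
      exact (Delta_apply_of_not c h').trans (Delta_apply_of_not _
        (show ¬ SameBlock A (Sum.inl ⟨k, p⟩) (Sum.inl ⟨l, q⟩) from h)).symm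
  · rfl
  · rfl
  · rw [gamma_apply]
    by_cases h : k = l
    · subst h
      simp only [Sum.swap_inr, Delta_inl, Delta_inr, (A k).str.inv.invol]
    · have h' : ¬ SameBlock A (Sum.inl ⟨l, q⟩) (Sum.inl ⟨k, p⟩) := Ne.symm h
      exact (Delta_apply_of_not c h').trans (Delta_apply_of_not _
        (show ¬ SameBlock A (Sum.inr ⟨k, p⟩) (Sum.inr ⟨l, q⟩) from h)).symm

theorem gamma_V {A : Fin m → SimpleStar F} {X : Amb A} (hX : X ∈ V A) :
    (gamma A).toLin X ∈ V A := by
  intro p q h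
  refine hX _ _ ?_
  rcases p with p | p <;> rcases q with q | q <;> simp_all [InV]

theorem gamma_mem {A : Fin m → SimpleStar F} {X : Amb A} (hX : X ∈ alg A) :
    (gamma A).toLin X ∈ alg A := by
  obtain ⟨c, v, hv, rfl⟩ := hX
  exact ⟨_, _, gamma_V hv, by rw [map_add, gamma_Delta]⟩

theorem Delta_mem {A : Fin m → SimpleStar F} (g : Fin m → ZMod 2) {i : ZMod 2}
    {c : ∀ k, (A k).Carrier} (hc : ∀ k, c k ∈ (A k).str.comp i) :
    Delta A c ∈ (elementaryGrading (F := F) (alpha A g)).comp i := by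
  have key : ∀ (k : Fin m) (p q : (A k).Idx),
      ((A k).deg p + g k) + ((A k).deg q + g k) = (A k).deg p + (A k).deg q := by
    intro k p q
    linear_combination zmod_two_add_self (g k)
  rintro (⟨k, p⟩ | ⟨k, p⟩) (⟨l, q⟩ | ⟨l, q⟩) h
  · by_cases hkl : k = l
    · subst hkl
      rw [Delta_inl]
      refine (A k).top_mem (hc k) p q ?_
      rw [← key]; exact h
    · exact Delta_apply_of_not c hkl
  · rfl
  · rfl
  · by_cases hkl : k = l
    · subst hkl
      rw [Delta_inr]
      refine (A k).top_mem ((A k).str.inv_mem (hc k)) q p ?_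
      rw [add_comm, ← key]; exact h
    · exact Delta_apply_of_not c hkl

theorem exists_decomp {R : Type v} [Ring R] [Algebra F R] (S : Superalg F R) (a : R) :
    ∃ y ∈ S.comp 0, ∃ z ∈ S.comp 1, y + z = a :=
  Submodule.mem_sup.1 (codisjoint_iff_le_sup.1 S.isCompl.2 (Submodule.mem_top (x := a)))

theorem alg_decomp {A : Fin m → SimpleStar F} (g : Fin m → ZMod 2) {X : Amb A}
    (hX : X ∈ alg A) :
    ∃ Y ∈ alg A, Y ∈ (elementaryGrading (F := F) (alpha A g)).comp 0 ∧
      ∃ Z ∈ alg A, Z ∈ (elementaryGrading (F := F) (alpha A g)).comp 1 ∧ Y + Z = X := by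
  obtain ⟨c, v, hv, rfl⟩ := hX
  choose c0 h0 c1 h1 hc using fun k => exists_decomp (A k).str.toSuperalg (c k)
  have hV : ∀ i, (Matrix.of fun p q => if alpha A g p + alpha A g q = i then v p q else 0) ∈ V A :=
    fun i p q h => by simp [hv p q h]
  refine ⟨_, ⟨c0, _, hV 0, rfl⟩, add_mem (Delta_mem g h0) fun p q h => if_neg h,
    _, ⟨c1, _, hV 1, rfl⟩, add_mem (Delta_mem g h1) fun p q h => if_neg h, ?_⟩
  have hcc : c = c0 + c1 := funext fun k => (hc k).symm
  rw [hcc, Delta_add, add_add_add_comm]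
  congr 1
  ext p q
  rcases zmod_two_eq_zero_or_one (alpha A g p + alpha A g q) with h | h <;> simp [h]

theorem gamma_comp {A : Fin m → SimpleStar F} (g : Fin m → ZMod 2) {i : ZMod 2} {X : Amb A}
    (hX : X ∈ (elementaryGrading (F := F) (alpha A g)).comp i) :
    (gamma A).toLin X ∈ (elementaryGrading (F := F) (alpha A g)).comp i := by
  intro p q h
  have hs : ∀ r : Pos A, alpha A g r.swap = alpha A g r := by rintro (r | r) <;> rfl
  exact hX _ _ (by rw [hs, hs, add_comm]; exact h)

/-- The `∗`-superalgebra `UT∗_{ℤ₂,g̃}(A₁, …, A_m)`: the algebra `UT∗(A₁, …, A_m)` with the elementary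
grading induced by `α_g̃` and the involution `γ_{2η_m}`. -/
def str (A : Fin m → SimpleStar F) (g : Fin m → ZMod 2) : StarSuperalg F (alg A) where
  comp i := ((elementaryGrading (alpha A g)).comp i).comap (alg A).val.toLinearMap
  isCompl := by
    refine ⟨Submodule.disjoint_def.2 fun X h0 h1 => ?_, codisjoint_iff_le_sup.2 fun X _ => ?_⟩
    · exact Subtype.ext
        (Submodule.disjoint_def.1 (elementaryGrading (alpha A g)).isCompl.1 _ h0 h1)
    · obtain ⟨Y, hY, hY0, Z, hZ, hZ1, h⟩ := alg_decomp g X.2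
      exact Submodule.mem_sup.2 ⟨⟨Y, hY⟩, hY0, ⟨Z, hZ⟩, hZ1, Subtype.ext h⟩
  mul_mem := fun ha hb => (elementaryGrading (alpha A g)).mul_mem ha hb
  inv :=
    { toLin := (gamma A).toLin.restrict
        (p := (alg A).toSubmodule) (q := (alg A).toSubmodule) fun _ h => gamma_mem h
      map_mul' := fun a b => Subtype.ext ((gamma A).map_mul' a b)
      invol := fun a => Subtype.ext ((gamma A).invol a) }
  inv_mem := fun h => gamma_comp g h

/-! ### The numbers attached to the sequence of blocks -/

/-- The dimensions `d₀⁺, d₀⁻, d₁⁺, d₁⁻` of the components of `A₁ ⊕ ⋯ ⊕ A_m`. -/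
noncomputable def dim (A : Fin m → SimpleStar F) (κ : VarKind) : ℕ := ∑ k, (A k).dim κ

/-- `m̄`: the number of blocks with trivial grading. -/
noncomputable def numTrivial (A : Fin m → SimpleStar F) : ℕ := {k | (A k).IsTrivial}.ncard

/-- `m̃`: the number of maximal strings of consecutive blocks with trivial grading, counted by
their first blocks. -/
noncomputable def numStrings (A : Fin m → SimpleStar F) : ℕ :=
  {k | (A k).IsTrivial ∧ ∀ j : Fin m, (j : ℕ) + 1 = k → ¬ (A j).IsTrivial}.ncard

/-- `r₀`: the number of pairs of consecutive blocks with trivial grading and equal `g`. -/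
noncomputable def r0 (A : Fin m → SimpleStar F) (g : Fin m → ZMod 2) : ℕ :=
  {p : Fin m × Fin m | (p.1 : ℕ) + 1 = p.2 ∧ (A p.1).IsTrivial ∧ (A p.2).IsTrivial ∧
    g p.1 = g p.2}.ncard

/-- `r₁`: the number of pairs of consecutive blocks with trivial grading and different `g`. -/
noncomputable def r1 (A : Fin m → SimpleStar F) (g : Fin m → ZMod 2) : ℕ :=
  {p : Fin m × Fin m | (p.1 : ℕ) + 1 = p.2 ∧ (A p.1).IsTrivial ∧ (A p.2).IsTrivial ∧
    g p.1 ≠ g p.2}.ncard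

/-- There are three consecutive blocks with trivial grading whose middle one is one-dimensional
(it has no nonzero skew elements) and has another `g` than both of its neighbours. -/
def Isolated (A : Fin m → SimpleStar F) (g : Fin m → ZMod 2) : Prop :=
  ∃ i j k : Fin m, (i : ℕ) + 1 = j ∧ (j : ℕ) + 1 = k ∧
    (A i).IsTrivial ∧ (A j).IsTrivial ∧ (A k).IsTrivial ∧
    Module.finrank F (A j).Carrier = 1 ∧ g i ≠ g j ∧ g k ≠ g j

end UT

/-! For every kind κ of variables there is a single threshold: with `m > 0` and `n > 0`, the Capelli
polynomials of rank `n` in variables of kind κ are identities exactly when `n > dim A κ + numLinks A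
g κ.deg`. Here `numLinks` counts the adjacent pairs of blocks `k, k+1` for which the part of `V`
between them contains a position of the degree of κ. In kind y⁻ sufficiency needs the absence of an
isolated block (`Isolated`); necessity always holds.

Sufficiency (`gradedCapelli_subset_identities`). By alternation it is enough to substitute distinct
generators of the component: basis elements of the blocks and elements `e_{p,q} ± e_{q',p'}` of `V`.
A nonzero product yields a path of nonzero entries that stays in one half of the matrix and moves
weakly monotonically through the blocks, so the block intervals of the generators do not overlap
(`hi_le_lo_of_prod_ne_zero`). A generator in `V` strictly jumps over a link, or over a block with a
nonzero component of kind κ (`exists_place`). Charging it to that link or basis element, and a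
diagonal generator to itself, is injective on the factors of the product, so there are at most `dim
+ numLinks` of them (`prod_gen_eq_zero`). An isolated block could be jumped over in kind y⁻ without
anything to charge.

Necessity (`lt_of_gradedCapelli_subset_identities`). List for `k = 1, …, m` a basis of the component
of `A_k`, followed by one unit pair for the link from `k` to `k+1` if there is one. The Capelli
expression of this list does not vanish for suitable intermediate elements. The list is built from
its end: whenever an element is put in front, intermediate elements are chosen so that a sum of rows
kills the terms starting with any other element of the list and, in the term starting with the new
one, reproduces a nonzero row already found (`exists_row_cons`). Inside a block this rests on the
dual separation of linearly independent matrices (`exists_separation`).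

It remains to count: an adjacent pair is not linked in degree `i` exactly when both gradings are
trivial and the sum of the two values of `g` is not `i`. Hence `numLinks` is `m - 1` minus `r₁` in
degree 0 and `m - 1` minus `r₀` in degree 1, and `r₀ + r₁ + m̃ = m̄` turns this into the stated
bounds. -/

/-! ### Capelli polynomials with a trailing factor -/

section CapelliFull

variable {F : Type u} {R : Type v} [Field F] [Ring R] [Algebra F R]

/-- The alternating sum `∑ sgn(σ) t_σ(0) y₀ t_σ(1) y₁ ⋯ t_σ(n-1) yₙ₋₁`. -/
def capelliFull (n : ℕ) (t : Fin n → R) (y : ℕ → R) : R :=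
  ∑ σ : Equiv.Perm (Fin n), (Equiv.Perm.sign σ : ℤ) •
    (List.ofFn fun i : Fin n => t (σ i) * y i).prod

theorem capelli_eq_capelliFull (n : ℕ) (t x : ℕ → R) :
    capelli n t x = capelliFull n (fun i => t i) (fun i => if i + 1 < n then x i else 1) := rfl

theorem capelliFull_zero (t : Fin 0 → R) (y : ℕ → R) : capelliFull 0 t y = 1 := by
  simp [capelliFull]

/-- Expansion along the first factor. A permutation with `σ 0 = j` is a permutation of the remaining
indices followed by the transposition of `0` and `j`, which contributes the sign -1 unless `j = 0`.
-/
theorem capelliFull_succ (n : ℕ) (t : Fin (n + 1) → R) (y : ℕ → R) :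
    capelliFull (n + 1) t y = ∑ j : Fin (n + 1), (if j = 0 then 1 else -1 : ℤ) •
      (t j * y 0 * capelliFull n (fun i => t (Equiv.swap 0 j i.succ)) fun i => y (i + 1)) := by
  simp only [capelliFull]
  rw [← Equiv.sum_comp Equiv.Perm.decomposeFin.symm, Fintype.sum_prod_type]
  refine Finset.sum_congr rfl fun j _ => ?_
  rw [Finset.mul_sum, Finset.smul_sum]
  refine Finset.sum_congr rfl fun σ _ => ?_
  rw [Equiv.Perm.decomposeFin.symm_sign, List.ofFn_succ, List.prod_cons]
  simp only [Equiv.Perm.decomposeFin_symm_apply_zero, Equiv.Perm.decomposeFin_symm_apply_succ,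
    Fin.val_zero, Fin.val_succ]
  rw [mul_smul_comm, smul_smul]
  congr 1
  split_ifs <;> simp

/-- Every summand ends in the same factor `y n`. Thus vanishing of the Capelli polynomial gives
vanishing of the version with a trailing factor, which is the one suited to recursion. -/
theorem capelliFull_mul_last (n : ℕ) (t : Fin (n + 1) → R) (y : ℕ → R) :
    capelliFull (n + 1) t y =
      capelliFull (n + 1) t (fun i => if i + 1 < n + 1 then y i else 1) * y n := by
  simp only [capelliFull, Finset.sum_mul]
  refine Finset.sum_congr rfl fun σ _ => ?_
  rw [smul_mul_assoc]
  congr 1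
  rw [List.ofFn_succ', List.ofFn_succ', List.concat_eq_append, List.concat_eq_append,
    List.prod_append, List.prod_append]
  simp [mul_assoc]

theorem map_capelli {S : Type*} [Ring S] [Algebra F S] (f : R →ₐ[F] S) (n : ℕ) (t x : ℕ → R) :
    f (capelli n t x) = capelli n (fun i => f (t i)) (fun i => f (x i)) := by
  simp only [capelli, map_sum, map_zsmul, map_list_prod, List.map_ofFn]
  refine Finset.sum_congr rfl fun σ _ => ?_
  congr 3
  funext i
  simp only [Function.comp, map_mul]
  split_ifs <;> simp

/-- `capelliFull` as an alternating map. -/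
noncomputable def capelliFullAlt (F : Type u) [Field F] [Algebra F R] (n : ℕ) (y : ℕ → R) :
    R [⋀^Fin n]→ₗ[F] R :=
  MultilinearMap.alternatization
    ((MultilinearMap.mkPiAlgebraFin F n R).compLinearMap fun i => LinearMap.mulRight F (y i))

theorem capelliFullAlt_apply (n : ℕ) (t : Fin n → R) (y : ℕ → R) :
    capelliFullAlt F n y t = capelliFull n t y := by
  simp only [capelliFullAlt, MultilinearMap.alternatization_apply, capelliFull]
  refine Finset.sum_congr rfl fun σ _ => ?_
  simp [Units.smul_def]

/-- Pulling back to the free module on `I` makes the family a basis, where an alternating map is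
determined by injective tuples. So no linear independence of `b` is needed. -/
theorem AlternatingMap.eq_zero_of_span {M N I : Type*} [AddCommGroup M] [Module F M]
    [AddCommGroup N] [Module F N] {n : ℕ} (f : M [⋀^Fin n]→ₗ[F] N) (b : I → M)
    (h : ∀ v : Fin n → I, Function.Injective v → f (fun i => b (v i)) = 0) (t : Fin n → M)
    (ht : ∀ i, t i ∈ Submodule.span F (Set.range b)) : f t = 0 := by
  have h0 : f.compLinearMap (Finsupp.linearCombination F b) = 0 := by
    refine Module.Basis.ext_alternating (Finsupp.basisSingleOne (R := F) (ι := I)) fun v hv => ?_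
    simpa using h v hv
  choose l hl using fun i => Finsupp.mem_span_range_iff_exists_finsupp.1 (ht i)
  have h1 := congrArg (fun g => g l) h0
  have h2 : (fun i => Finsupp.linearCombination F b (l i)) = t := funext hl
  simpa [AlternatingMap.compLinearMap_apply, h2] using h1

/-- A nonzero entry of a product of matrices yields a path of nonzero entries. -/
theorem exists_path_of_list_prod_ne_zero {ι : Type*} [Fintype ι] [DecidableEq ι] (n : ℕ)
    (M : Fin n → Matrix ι ι F) (p q : ι) (h : (List.ofFn M).prod p q ≠ 0) :
    ∃ r : ℕ → ι, r 0 = p ∧ ∀ i : Fin n, M i (r i) (r (i + 1)) ≠ 0 := by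
  induction n generalizing p with
  | zero => exact ⟨fun _ => p, rfl, fun i => i.elim0⟩
  | succ n ih =>
    rw [List.ofFn_succ, List.prod_cons, Matrix.mul_apply] at h
    obtain ⟨s, -, hs⟩ := Finset.exists_ne_zero_of_sum_ne_zero h
    obtain ⟨r, hr0, hr⟩ := ih _ s (right_ne_zero_of_mul hs)
    refine ⟨fun i => Nat.casesOn i p r, rfl, Fin.cases ?_ fun i => ?_⟩
    · simpa [hr0] using left_ne_zero_of_mul hs
    · exact hr i

end CapelliFull

/-! ### Identities and evaluations -/

section Identities

variable {F : Type u} {R : Type v} [Field F] [Ring R] [Algebra F R]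

theorem gradedCapelli_subset_of_capelli_eq_zero (S : StarSuperalg F R) (κ : VarKind) (n : ℕ)
    (h : ∀ t x : ℕ → R, (∀ i, t i ∈ S.part κ) → capelli n t x = 0) :
    gradedCapelli F κ n ⊆ S.identities := by
  rintro _ ⟨ε, rfl⟩ φ hφ
  rw [map_capelli]
  simpa using h _ _ fun i => by simpa using hφ (κ, i)

theorem capelli_eq_zero_of_gradedCapelli_subset {S : StarSuperalg F R} {κ : VarKind} {n : ℕ}
    (h : gradedCapelli F κ n ⊆ S.identities) (t x : ℕ → R) (ht : ∀ i, t i ∈ S.part κ)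
    (hx : ∀ j, ∃ δ, x j ∈ S.part δ) : capelli n t x = 0 := by
  choose ε hε using hx
  classical
  -- Indices below `n` belong to the alternating variables and the index `n + j` to the `j`-th
  -- intermediate one. All variables that do not occur in the polynomial are sent to 0, which lies
  -- in every component.
  let φ : VarKind × ℕ → R := fun v =>
    if v.2 < n then (if v.1 = κ then t v.2 else 0) else if v.1 = ε (v.2 - n) then x (v.2 - n) else 0
  have hφ : ∀ v, φ v ∈ S.part v.1 := by
    rintro ⟨δ, i⟩
    simp only [φ]
    split_ifs with h1 h2 h2
    · exact h2 ▸ ht i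
    · exact zero_mem _
    · exact h2 ▸ hε _
    · exact zero_mem _
  have := h ⟨ε, rfl⟩ φ hφ
  rw [map_capelli] at this
  rw [← this]
  simp only [FreeAlgebra.lift_ι_apply, capelli]
  simp [φ]

theorem capelliFull_eq_zero_of_gradedCapelli_subset {S : StarSuperalg F R} {κ : VarKind} {n : ℕ}
    (hn : 0 < n) (h : gradedCapelli F κ n ⊆ S.identities) (t : Fin n → R) (y : ℕ → R)
    (ht : ∀ i, t i ∈ S.part κ) (hy : ∀ j, ∃ δ, y j ∈ S.part δ) : capelliFull n t y = 0 := by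
  obtain ⟨n, rfl⟩ := Nat.exists_eq_succ_of_ne_zero hn.ne'
  have := capelli_eq_zero_of_gradedCapelli_subset h
    (fun i => if hi : i < n + 1 then t ⟨i, hi⟩ else 0) y
    (fun i => by split_ifs; exacts [ht _, zero_mem _]) hy
  rw [capelli_eq_capelliFull] at this
  change capelliFull (n + 1) t y = 0
  rw [capelliFull_mul_last]
  simp only [Fin.is_lt, dite_true, Fin.eta] at this
  rw [this, zero_mul]

/-- Expanding along the first factor writes the longer expression through expressions of rank one
less in the same kind of variables. -/
theorem capelliFull_eq_zero_of_le {S : StarSuperalg F R} {κ : VarKind} {n n' : ℕ} (hn : 0 < n)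
    (hnn : n ≤ n') (h : gradedCapelli F κ n ⊆ S.identities) (t : Fin n' → R) (y : ℕ → R)
    (ht : ∀ i, t i ∈ S.part κ) (hy : ∀ j, ∃ δ, y j ∈ S.part δ) : capelliFull n' t y = 0 := by
  induction n', hnn using Nat.le_induction generalizing y with
  | base => exact capelliFull_eq_zero_of_gradedCapelli_subset hn h t y ht hy
  | succ n' _ ih =>
    rw [capelliFull_succ]
    refine Finset.sum_eq_zero fun j _ => ?_
    rw [ih _ _ (fun i => ht _) fun j => hy _, mul_zero, smul_zero]

/-- Each homogeneous part is split by halving `b + b∗` and `b - b∗`. This allows arbitrary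
intermediate elements to be replaced by admissible ones. -/
theorem StarSuperalg.sum_part [CharZero F] (S : StarSuperalg F R) (a : R) :
    ∃ a₀ ∈ S.part .evenSym, ∃ a₁ ∈ S.part .evenSkew, ∃ a₂ ∈ S.part .oddSym,
      ∃ a₃ ∈ S.part .oddSkew, a = a₀ + a₁ + a₂ + a₃ := by
  obtain ⟨b, hb, c, hc, rfl⟩ := UT.exists_decomp S.toSuperalg a
  have key : ∀ i, ∀ b ∈ S.comp i, ∃ b₀ ∈ S.symPart i, ∃ b₁ ∈ S.skewPart i, b = b₀ + b₁ := by
    intro i b hb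
    refine ⟨(2⁻¹ : F) • (b + S.inv.toLin b), ?_, (2⁻¹ : F) • (b - S.inv.toLin b), ?_, ?_⟩
    · rw [S.mem_symPart]
      refine ⟨Submodule.smul_mem _ _ (add_mem hb (S.inv_mem hb)), ?_⟩
      rw [map_smul, map_add, S.inv.invol, add_comm]
    · rw [S.mem_skewPart]
      refine ⟨Submodule.smul_mem _ _ (sub_mem hb (S.inv_mem hb)), ?_⟩
      rw [map_smul, map_sub, S.inv.invol, ← smul_neg, neg_sub]
    · rw [← smul_add, add_add_sub_cancel, ← two_smul F b, smul_smul,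
        inv_mul_cancel₀ two_ne_zero, one_smul]
  obtain ⟨b₀, h₀, b₁, h₁, rfl⟩ := key 0 b hb
  obtain ⟨c₀, h₂, c₁, h₃, rfl⟩ := key 1 c hc
  exact ⟨b₀, h₀, b₁, h₁, c₀, h₂, c₁, h₃, by abel⟩

end Identities

/-! ### The blocks -/

namespace SimpleStar

variable {F : Type u} [Field F]

instance instFiniteCarrier : (A : SimpleStar F) → Module.Finite F A.Carrier
  | mat h l _ _ _ _ => inferInstanceAs (Module.Finite F (MHL F h l))
  | matExc h l _ _ =>
    haveI : Module.Finite F (MHL F h l)ᵐᵒᵖ :=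
      Module.Finite.equiv (MulOpposite.opLinearEquiv F (M := MHL F h l))
    inferInstanceAs (Module.Finite F (MHL F h l × (MHL F h l)ᵐᵒᵖ))
  | cStar n _ _ =>
    haveI : Module.Finite F (QuadraticAlgebra F (1 : F) 0) :=
      Module.Finite.of_basis (QuadraticAlgebra.basis (1 : F) 0)
    inferInstanceAs (Module.Finite F (MC F n))
  | cDagger n _ _ =>
    haveI : Module.Finite F (QuadraticAlgebra F (1 : F) 0) :=
      Module.Finite.of_basis (QuadraticAlgebra.basis (1 : F) 0)
    inferInstanceAs (Module.Finite F (MC F n))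
  | cExc n _ =>
    haveI : Module.Finite F (QuadraticAlgebra F (1 : F) 0) :=
      Module.Finite.of_basis (QuadraticAlgebra.basis (1 : F) 0)
    haveI : Module.Finite F (MC F n)ᵐᵒᵖ :=
      Module.Finite.equiv (MulOpposite.opLinearEquiv F (M := MC F n))
    inferInstanceAs (Module.Finite F (MC F n × (MC F n)ᵐᵒᵖ))

theorem evenSize_pos (A : SimpleStar F) : 0 < A.evenSize := by
  cases A <;> exact Nat.pos_of_ne_zero ‹_›

theorem toMat_injective {n : ℕ} : Function.Injective (MC.toMat (F := F) (n := n)) := by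
  intro X Y h
  obtain ⟨h0, h1, -, -⟩ := Matrix.fromBlocks_inj.1 h
  exact MC.ext' h0 h1

/-- In the exchange families `top` sees only the first component; the involution moves the second
one there. In the other families `top` alone is injective. -/
theorem eq_zero_of_top {A : SimpleStar F} {c : A.Carrier} (h0 : A.top c = 0)
    (h1 : A.top (A.str.inv.toLin c) = 0) : c = 0 := by
  cases A with
  | mat h l hl hh d hd => exact h0
  | matExc h l hl hh => exact Prod.ext h0 (MulOpposite.unop_injective h1)
  | cStar n hn d => exact toMat_injective (h0.trans (map_zero _).symm)
  | cDagger n hn d => exact toMat_injective (h0.trans (map_zero _).symm)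
  | cExc n hn =>
    exact Prod.ext (toMat_injective (h0.trans (map_zero _).symm))
      (MulOpposite.unop_injective (toMat_injective (h1.trans (map_zero _).symm)))

/-- The sign of a kind of variables: `1` for symmetric, `-1` for skew ones. -/
def _root_.VarKind.sign : VarKind → ℤˣ
  | .evenSym => 1
  | .evenSkew => -1
  | .oddSym => 1
  | .oddSkew => -1

/-- The degree of a kind of variables. -/
def _root_.VarKind.deg : VarKind → ZMod 2
  | .evenSym => 0
  | .evenSkew => 0
  | .oddSym => 1
  | .oddSkew => 1

theorem _root_.StarSuperalg.mem_part {R : Type v} [Ring R] [Algebra F R] (S : StarSuperalg F R)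
    (κ : VarKind) (a : R) :
    a ∈ S.part κ ↔ a ∈ S.comp κ.deg ∧ S.inv.toLin a = (κ.sign : ℤ) • a := by
  cases κ <;>
    simp [StarSuperalg.part, VarKind.deg, VarKind.sign, S.mem_symPart, S.mem_skewPart]

/-- For symmetric or skew `c` the images of `c` and `c∗` agree up to sign, so `top` loses nothing,
even in the exchange families. -/
theorem top_injOn_part {A : SimpleStar F} {κ : VarKind} {c : A.Carrier} (hc : c ∈ A.str.part κ)
    (h : A.top c = 0) : c = 0 :=
  eq_zero_of_top h (by rw [((A.str.mem_part κ c).1 hc).2, map_zsmul, h, smul_zero])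

/-- Odd witnesses are a matrix unit between an even and an odd row in `M_{h,l}`, and `c` itself in
`M_n + cM_n`. The families built on `c` are therefore never trivially graded. -/
theorem isTrivial_iff (A : SimpleStar F) : A.IsTrivial ↔ A.oddSize = 0 := by
  have hE : ∀ (h l : ℕ), h ≠ 0 → ((gradingHL F h l).comp 1 = ⊥ ↔ l = 0) := by
    intro h l hh
    constructor
    · intro H
      by_contra hl
      have : Matrix.single (Sum.inl ⟨0, Nat.pos_of_ne_zero hh⟩ : Fin h ⊕ Fin l)
          (Sum.inr ⟨0, Nat.pos_of_ne_zero hl⟩) (1 : F) ∈ (gradingHL F h l).comp 1 := by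
        intro p q hpq
        refine Matrix.single_apply_of_ne _ _ _ _ _ ?_
        rintro ⟨rfl, rfl⟩
        exact hpq (by simp [blockDeg])
      rw [H, Submodule.mem_bot] at this
      simpa using congrFun (congrFun this (Sum.inl ⟨0, Nat.pos_of_ne_zero hh⟩))
        (Sum.inr ⟨0, Nat.pos_of_ne_zero hl⟩)
    · rintro rfl
      refine (Submodule.eq_bot_iff _).2 fun X hX => ?_
      ext p q
      rcases p with p | p
      · rcases q with q | q
        · exact hX _ _ (by simp [blockDeg])
        · exact q.elim0
      · exact p.elim0
  have hC : ∀ n : ℕ, n ≠ 0 → (gradingMC F n).comp 1 ≠ ⊥ := by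
    intro n hn H
    have : MC.mk 0 1 ∈ (gradingMC F n).comp 1 := by simp [gradingMC]
    rw [H, Submodule.mem_bot] at this
    have h1 := congrArg MC.im this
    rw [MC.im_mk, map_zero] at h1
    simpa using congrFun (congrFun h1 ⟨0, Nat.pos_of_ne_zero hn⟩) ⟨0, Nat.pos_of_ne_zero hn⟩
  have hX : ∀ {R : Type u} [Ring R] [Algebra F R] (S : Superalg F R),
      (exchange S).comp 1 = ⊥ ↔ S.comp 1 = ⊥ := by
    intro R _ _ S
    simp only [Submodule.eq_bot_iff]
    constructor
    · exact fun H x hx => congrArg Prod.fst (H (x, 0) ⟨hx, zero_mem _⟩)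
    · exact fun H x hx => Prod.ext (H _ hx.1) (MulOpposite.unop_injective (H _ hx.2))
  cases A with
  | mat h l hl hh d hd => exact hE h l hh
  | matExc h l hl hh => exact (hX _).trans (hE h l hh)
  | cStar n hn d => exact iff_of_false (hC n hn) hn
  | cDagger n hn d => exact iff_of_false (hC n hn) hn
  | cExc n hn => exact iff_of_false (fun H => hC n hn ((hX _).1 H)) hn

theorem one_mem_part (A : SimpleStar F) : (1 : A.Carrier) ∈ A.str.part .evenSym := by
  rw [StarSuperalg.mem_part]
  refine ⟨?_, by simp [UT.inv_one, VarKind.sign]⟩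
  have h1 : (1 : MHL F A.evenSize A.oddSize) ∈ (gradingHL F A.evenSize A.oddSize).comp 0 := by
    intro p q hpq
    refine Matrix.one_apply_ne ?_
    rintro rfl
    exact hpq (zmod_two_add_self _)
  have h2 : ∀ n, (1 : MC F n) ∈ (gradingMC F n).comp 0 := by
    intro n; simp [gradingMC, MC.im_one]
  cases A with
  | mat h l hl hh d hd => exact h1
  | matExc h l hl hh => exact ⟨h1, h1⟩
  | cStar n hn d => exact h2 n
  | cDagger n hn d => exact h2 n
  | cExc n hn => exact ⟨h2 n, h2 n⟩

theorem nontrivial_carrier (A : SimpleStar F) : Nontrivial A.Carrier := by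
  have : Nonempty A.Idx := ⟨Sum.inl ⟨0, A.evenSize_pos⟩⟩
  exact ⟨⟨1, 0, fun h => by simpa using congrArg A.top h⟩⟩

theorem dim_evenSym_pos (A : SimpleStar F) : 0 < A.dim .evenSym := by
  have := A.nontrivial_carrier
  exact Module.finrank_pos_iff_exists_ne_zero.2
    ⟨⟨1, A.one_mem_part⟩, fun h => one_ne_zero (congrArg Subtype.val h)⟩

/-- If a trivially graded block had no skew elements, its involution would be the identity. Being an
antiautomorphism, it would force commutativity, which leaves only the field. With an exchange
involution the identity is already impossible. -/
theorem dim_evenSkew_pos [CharZero F] {A : SimpleStar F} (hA : A.IsTrivial)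
    (h1 : Module.finrank F A.Carrier ≠ 1) : 0 < A.dim .evenSkew := by
  by_contra h0
  have hbot : A.str.part .evenSkew = ⊥ := Submodule.finrank_eq_zero.1 (Nat.eq_zero_of_not_pos h0)
  have hinv : ∀ a : A.Carrier, A.str.inv.toLin a = a := by
    intro a
    have hmem : A.str.inv.toLin a - a ∈ A.str.part .evenSkew := by
      rw [StarSuperalg.mem_part]
      refine ⟨?_, by simp [VarKind.sign, A.str.inv.invol]⟩
      obtain ⟨y, hy, z, hz, hyz⟩ := UT.exists_decomp A.str.toSuperalg (A.str.inv.toLin a - a)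
      rw [show A.str.comp 1 = ⊥ from hA, Submodule.mem_bot] at hz
      rw [← hyz, hz, add_zero]
      exact hy
    rw [hbot, Submodule.mem_bot] at hmem
    exact sub_eq_zero.1 hmem
  have hcomm : ∀ a b : A.Carrier, a * b = b * a := fun a b => by
    rw [← hinv (a * b), A.str.inv.map_mul', hinv, hinv]
  have hodd := (isTrivial_iff A).1 hA
  cases A with
  | mat h l hl hh d hd =>
    obtain rfl : l = 0 := hodd
    by_cases h2 : h = 1
    · subst h2
      refine h1 ?_
      change Module.finrank F (MHL F 1 0) = 1
      simp [Module.finrank_matrix]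
    · let x : Fin h ⊕ Fin 0 := Sum.inl ⟨0, by omega⟩
      let y : Fin h ⊕ Fin 0 := Sum.inl ⟨1, by omega⟩
      have hxy : y ≠ x := by simp [x, y]
      have h3 : Matrix.single x y (1 : F) * Matrix.single y x 1 =
        Matrix.single y x 1 * Matrix.single x y 1 := hcomm _ _
      simpa [hxy] using congrFun (congrFun h3 x) x
  | matExc h l hl hh =>
    have : Nonempty (Fin h ⊕ Fin l) := ⟨Sum.inl ⟨0, Nat.pos_of_ne_zero hh⟩⟩
    exact one_ne_zero (congrArg Prod.fst (hinv (0, 1)) : (1 : MHL F h l) = 0)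
  | cStar n hn d => exact hn hodd
  | cDagger n hn d => exact hn hodd
  | cExc n hn => exact hn hodd

/-! ### Separation of linearly independent elements inside a block -/

/-- The coordinate functional of `T i` extends from the span to all matrices, and its values on
matrix units are the coefficients `f`. -/
theorem exists_separating_coeff {n I : Type*} [Fintype n] [DecidableEq I]
    {T : I → Matrix n n F} (hT : LinearIndependent F T) (i : I) :
    ∃ f : Matrix n n F, ∀ j, ∑ p, ∑ q, T j p q * f p q = if j = i then 1 else 0 := by
  classical
  obtain ⟨φ, hφ⟩ := LinearMap.exists_extend (Finsupp.lapply i ∘ₗ hT.repr)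
  refine ⟨Matrix.of fun p q => φ (Matrix.single p q 1), fun j => ?_⟩
  have h1 : φ (T j) = if j = i then 1 else 0 := by
    have := LinearMap.congr_fun hφ ⟨T j, Submodule.subset_span ⟨j, rfl⟩⟩
    simpa [hT.repr_eq_single j ⟨T j, _⟩ rfl, Finsupp.single_apply] using this
  rw [← h1]
  conv_rhs => rw [Matrix.matrix_eq_sum_single (T j)]
  simp only [map_sum, Matrix.of_apply]
  refine Finset.sum_congr rfl fun p _ => Finset.sum_congr rfl fun q _ => ?_
  rw [← smul_eq_mul, ← map_smul, Matrix.smul_single, smul_eq_mul, mul_one]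

/-- Put row `p` of the separating coefficients into column `p₀` of `c p`. Then the sum over `p` of
row `p` of `T j * c p` is the separating functional of `T j`, placed at `p₀`. -/
theorem exists_separation_matrix {n I : Type*} [Fintype n] [DecidableEq n] [DecidableEq I]
    {T : I → Matrix n n F} (hT : LinearIndependent F T) (p₀ : n) (i : I) :
    ∃ c : n → Matrix n n F, ∀ j q,
      ∑ p, (T j * c p) p q = if j = i ∧ q = p₀ then 1 else 0 := by
  obtain ⟨f, hf⟩ := exists_separating_coeff hT i
  refine ⟨fun p => Matrix.of fun q r => if r = p₀ then f p q else 0, fun j q => ?_⟩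
  by_cases hq : q = p₀
  · simp [Matrix.mul_apply, hq, hf j]
  · simp [Matrix.mul_apply, hq]

/-- A homogeneous element is carried by its real or its imaginary part. Multiplying by elements of
the same degree makes all products even, which reduces the claim to ordinary matrices. -/
theorem exists_separation_MC {n : ℕ} {I : Type*} [DecidableEq I] {X : I → MC F n} {d : ZMod 2}
    (hX : ∀ i, X i ∈ (gradingMC F n).comp d) (hli : LinearIndependent F fun i => MC.toMat (X i))
    (p₀ : Fin n) (i : I) :
    ∃ c : Fin n ⊕ Fin n → MC F n, ∀ j q,
      ∑ p, (MC.toMat (X j) * MC.toMat (c p)) p q = if j = i ∧ q = Sum.inl p₀ then 1 else 0 := by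
  have hli' : LinearIndependent F X := LinearIndependent.of_comp MC.toMat.toLinearMap hli
  have key : ∃ Y : Matrix (Fin n) (Fin n) F →ₗ[F] MC F n, ∃ T : I → Matrix (Fin n) (Fin n) F,
      LinearIndependent F T ∧ ∀ j M, X j * Y M = MC.mk (T j * M) 0 := by
    rcases zmod_two_eq_zero_or_one d with rfl | rfl
    · have h0 : ∀ j, MC.im (X j) = 0 := fun j => by simpa [gradingMC] using hX j
      refine ⟨{ toFun := fun M => MC.mk M 0, map_add' := fun _ _ => MC.ext' (by simp) (by simp),
                map_smul' := fun _ _ => MC.ext' (by simp) (by simp) },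
              fun j => MC.re (X j), hli'.map ?_, fun j M => MC.ext' ?_ ?_⟩
      · refine Submodule.disjoint_def.2 fun x hx hx' => MC.ext' (by simpa using hx') ?_
        have : Submodule.span F (Set.range X) ≤ LinearMap.ker MC.im :=
          Submodule.span_le.2 (by rintro _ ⟨j, rfl⟩; exact h0 j)
        simpa using this hx
      · simp [MC.re_mul]
      · simp [MC.im_mul, h0]
    · have h0 : ∀ j, MC.re (X j) = 0 := fun j => by simpa [gradingMC] using hX j
      refine ⟨{ toFun := fun M => MC.mk 0 M, map_add' := fun _ _ => MC.ext' (by simp) (by simp),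
                map_smul' := fun _ _ => MC.ext' (by simp) (by simp) },
              fun j => MC.im (X j), hli'.map ?_, fun j M => MC.ext' ?_ ?_⟩
      · refine Submodule.disjoint_def.2 fun x hx hx' => MC.ext' ?_ (by simpa using hx')
        have : Submodule.span F (Set.range X) ≤ LinearMap.ker MC.re :=
          Submodule.span_le.2 (by rintro _ ⟨j, rfl⟩; exact h0 j)
        simpa using this hx
      · simp [MC.re_mul]
      · simp [MC.im_mul, h0]
  obtain ⟨Y, T, hT, hYT⟩ := key
  obtain ⟨c, hc⟩ := exists_separation_matrix hT p₀ i
  -- The upper half of the rows of `toMat` already separates, so the lower half gets coefficient 0.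
  refine ⟨Sum.elim (fun p => Y (c p)) 0, fun j q => ?_⟩
  rw [Fintype.sum_sum_type]
  simp only [← map_mul, Sum.elim_inl, hYT, Sum.elim_inr, Pi.zero_apply, mul_zero, map_zero,
    Matrix.zero_apply, Finset.sum_const_zero, add_zero]
  rcases q with q | q
  · simpa [MC.toMat] using hc j q
  · simp [MC.toMat]

/-- Linearly independent homogeneous elements of the same kind are separated by sums of rows of
right multiples. -/
theorem exists_separation (A : SimpleStar F) (κ : VarKind) {I : Type*} [DecidableEq I]
    {t : I → A.Carrier} (ht : ∀ i, t i ∈ A.str.part κ) (hli : LinearIndependent F t) :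
    ∃ p₀ : A.Idx, ∀ i, ∃ c : A.Idx → A.Carrier, ∀ j q,
      ∑ p, (A.top (t j) * A.top (c p)) p q = if j = i ∧ q = p₀ then 1 else 0 := by
  have hT : LinearIndependent F fun i => A.top (t i) := by
    refine hli.map (f := A.top.toLinearMap) (Submodule.disjoint_def.2 fun x hx hx' => ?_)
    have : Submodule.span F (Set.range t) ≤ A.str.part κ :=
      Submodule.span_le.2 (by rintro _ ⟨j, rfl⟩; exact ht j)
    exact top_injOn_part (this hx) hx'
  refine ⟨Sum.inl ⟨0, A.evenSize_pos⟩, fun i => ?_⟩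
  have hd := fun i => ((A.str.mem_part κ (t i)).1 (ht i)).1
  cases A with
  | mat h l hl hh d hd => exact exists_separation_matrix hT _ i
  | matExc h l hl hh =>
    obtain ⟨c, hc⟩ := exists_separation_matrix hT _ i
    exact ⟨fun p => (c p, 0), hc⟩
  | cStar n hn d => exact exists_separation_MC hd hT _ i
  | cDagger n hn d => exact exists_separation_MC hd hT _ i
  | cExc n hn =>
    obtain ⟨c, hc⟩ := exists_separation_MC (fun i => (hd i).1) hT _ i
    exact ⟨fun p => (c p, 0), hc⟩

/-- Some element of a block moves a given row to another given one. -/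
theorem exists_row_eq (A : SimpleStar F) (p p' : A.Idx) :
    ∃ c : A.Carrier, ∀ q, A.top c p q = if q = p' then 1 else 0 := by
  have hE : ∀ {ι : Type} [DecidableEq ι] (p p' q : ι),
      Matrix.single p p' (1 : F) p q = if q = p' then 1 else 0 := by
    intro ι _ p p' q
    simp [Matrix.single_apply, eq_comm]
  have hC : ∀ {n : ℕ} (p p' : Fin n ⊕ Fin n), ∃ X : MC F n, ∀ q,
      MC.toMat X p q = if q = p' then 1 else 0 := by
    rintro n (p | p) (p' | p')
    · exact ⟨MC.mk (Matrix.single p p' 1) 0, by rintro (q | q) <;> simp [MC.toMat, hE]⟩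
    · exact ⟨MC.mk 0 (Matrix.single p p' 1), by rintro (q | q) <;> simp [MC.toMat, hE]⟩
    · exact ⟨MC.mk 0 (Matrix.single p p' 1), by rintro (q | q) <;> simp [MC.toMat, hE]⟩
    · exact ⟨MC.mk (Matrix.single p p' 1) 0, by rintro (q | q) <;> simp [MC.toMat, hE]⟩
  cases A with
  | mat h l hl hh d hd => exact ⟨Matrix.single p p' 1, hE p p'⟩
  | matExc h l hl hh => exact ⟨(Matrix.single p p' 1, 0), hE p p'⟩
  | cStar n hn d => exact hC p p'
  | cDagger n hn d => exact hC p p'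
  | cExc n hn =>
    obtain ⟨X, hX⟩ := hC p p'
    exact ⟨(X, 0), hX⟩

end SimpleStar

/-! ### The structure of `UT∗(A₁, …, A_m)` -/

namespace SimpleStar

variable {F : Type u} [Field F]

theorem deg_eq_zero {A : SimpleStar F} (hA : A.IsTrivial) (p : A.Idx) : A.deg p = 0 := by
  rw [isTrivial_iff] at hA
  rcases p with p | p
  · rfl
  · exact (Fin.cast hA p).elim0

theorem exists_deg_eq_zero (A : SimpleStar F) : ∃ p, A.deg p = 0 :=
  ⟨Sum.inl ⟨0, A.evenSize_pos⟩, rfl⟩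

theorem exists_deg_eq {A : SimpleStar F} (hA : ¬ A.IsTrivial) (d : ZMod 2) :
    ∃ p, A.deg p = d := by
  rw [isTrivial_iff] at hA
  rcases zmod_two_eq_zero_or_one d with rfl | rfl
  · exact A.exists_deg_eq_zero
  · exact ⟨Sum.inr ⟨0, Nat.pos_of_ne_zero hA⟩, rfl⟩

end SimpleStar

namespace UT

variable {F : Type u} [Field F] {m : ℕ}

/-- The block `V_{k,l}` next to the diagonal has an entry of degree `i`. -/
def Linked (A : Fin m → SimpleStar F) (g : Fin m → ZMod 2) (i : ZMod 2) (k l : Fin m) : Prop :=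
  (k : ℕ) + 1 = l ∧ ∃ p q, ((A k).deg p + g k) + ((A l).deg q + g l) = i

/-- A nontrivially graded block has rows of both degrees, so any degree can be reached from or to
it. Between two trivially graded blocks the only degree is `g k + g l`. -/
theorem linked_iff {A : Fin m → SimpleStar F} {g : Fin m → ZMod 2} {i : ZMod 2} {k l : Fin m} :
    Linked A g i k l ↔
      (k : ℕ) + 1 = l ∧ (¬ ((A k).IsTrivial ∧ (A l).IsTrivial) ∨ g k + g l = i) := by
  refine and_congr_right fun _ => ⟨?_, ?_⟩
  · rintro ⟨p, q, h⟩
    by_cases hT : (A k).IsTrivial ∧ (A l).IsTrivial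
    · rw [SimpleStar.deg_eq_zero hT.1, SimpleStar.deg_eq_zero hT.2, zero_add, zero_add] at h
      exact Or.inr h
    · exact Or.inl hT
  · obtain ⟨p, hp⟩ := (A k).exists_deg_eq_zero
    obtain ⟨q, hq⟩ := (A l).exists_deg_eq_zero
    rintro (h | h)
    · rcases not_and_or.1 h with h | h
      · obtain ⟨p, hp⟩ := SimpleStar.exists_deg_eq h (i - g k - g l)
        exact ⟨p, q, by rw [hp, hq]; ring⟩
      · obtain ⟨q, hq⟩ := SimpleStar.exists_deg_eq h (i - g k - g l)
        exact ⟨p, q, by rw [hp, hq]; ring⟩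
    · exact ⟨p, q, by rw [hp, hq, zero_add, zero_add, h]⟩

/-- The number of blocks next to the diagonal with an entry of degree `i`. -/
noncomputable def numLinks (A : Fin m → SimpleStar F) (g : Fin m → ZMod 2) (i : ZMod 2) : ℕ :=
  {p : Fin m × Fin m | Linked A g i p.1 p.2}.ncard

theorem mem_part_iff {A : Fin m → SimpleStar F} {g : Fin m → ZMod 2} {κ : VarKind} {x : alg A} :
    x ∈ (str A g).part κ ↔ (x : Amb A) ∈ (elementaryGrading (F := F) (alpha A g)).comp κ.deg ∧
      (gamma A).toLin (x : Amb A) = (κ.sign : ℤ) • (x : Amb A) := by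
  rw [StarSuperalg.mem_part]
  exact and_congr_right fun _ => Subtype.ext_iff

/-- The two halves of the matrix record the images under `top` of `c k` and of its adjoint, which
together determine `c k`. -/
theorem Delta_injective (A : Fin m → SimpleStar F) : Function.Injective (Delta A) := by
  intro c e h
  funext k
  rw [← sub_eq_zero]
  refine SimpleStar.eq_zero_of_top ?_ ?_
  · ext p q
    rw [map_sub, Matrix.sub_apply, ← Delta_inl, ← Delta_inl, h, sub_self]
    rfl
  · ext p q
    rw [map_sub, map_sub, Matrix.sub_apply, ← Delta_inr, ← Delta_inr, h, sub_self]
    rfl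

theorem not_inV_of_sameBlock {A : Fin m → SimpleStar F} {p q : Pos A} (h : SameBlock A p q) :
    ¬ InV A p q := by
  rcases p with p | p <;> rcases q with q | q
  · exact (show p.1 = q.1 from h).not_lt
  · exact id
  · exact id
  · exact (show p.1 = q.1 from h).symm.not_lt

theorem Delta_zero (A : Fin m → SimpleStar F) : Delta A 0 = 0 := by
  simpa using Delta_smul A (0 : F) 0

theorem eq_zero_of_Delta_mem_V {A : Fin m → SimpleStar F} {c : ∀ k, (A k).Carrier}
    (h : Delta A c ∈ V A) : c = 0 := by
  refine Delta_injective A ?_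
  rw [Delta_zero]
  ext p q
  by_cases hpq : SameBlock A p q
  · exact h p q (not_inV_of_sameBlock hpq)
  · exact Delta_apply_of_not c hpq

theorem exists_decomp_deg {R : Type v} [Ring R] [Algebra F R] (S : Superalg F R) (d : ZMod 2)
    (a : R) : ∃ y ∈ S.comp d, ∃ z ∈ S.comp (d + 1), y + z = a := by
  obtain ⟨y, hy, z, hz, h⟩ := exists_decomp S a
  rcases zmod_two_eq_zero_or_one d with rfl | rfl
  · exact ⟨y, hy, z, by simpa using hz, h⟩
  · exact ⟨z, hz, y, hy, by rw [add_comm, h]⟩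

theorem eq_zero_of_mem_comp_add_one {ι : Type} [Fintype ι] [DecidableEq ι] {α : ι → ZMod 2}
    {d : ZMod 2} {X : Matrix ι ι F} (h0 : X ∈ (elementaryGrading α).comp d)
    (h1 : X ∈ (elementaryGrading α).comp (d + 1)) : X = 0 := by
  ext p q
  by_cases h : α p + α q = d
  · exact h1 p q (by rw [h]; simp)
  · exact h0 p q h

/-- Grading and involution respect the decomposition into `D` and `V`. The part of `c` of the wrong
degree has an image in two degrees at once, and the image of `c∗ ∓ c` lies in `D ∩ V`; both are
zero, and `Delta` is injective. -/
theorem mem_part_of_add_mem_part {A : Fin m → SimpleStar F} {g : Fin m → ZMod 2} {κ : VarKind}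
    {c : ∀ k, (A k).Carrier} {v : Amb A} (hv : v ∈ V A)
    (hd : Delta A c + v ∈ (elementaryGrading (F := F) (alpha A g)).comp κ.deg)
    (hs : (gamma A).toLin (Delta A c + v) = (κ.sign : ℤ) • (Delta A c + v)) (k : Fin m) :
    c k ∈ (A k).str.part κ := by
  have hDd : Delta A c ∈ (elementaryGrading (F := F) (alpha A g)).comp κ.deg := by
    intro p q h
    by_cases hpq : SameBlock A p q
    · have := hd p q h
      rwa [Matrix.add_apply, hv p q (not_inV_of_sameBlock hpq), add_zero] at this
    · exact Delta_apply_of_not c hpq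
  rw [StarSuperalg.mem_part]
  constructor
  · choose y hy z hz hyz using fun k => exists_decomp_deg (A k).str.toSuperalg κ.deg (c k)
    have hc : c = y + z := funext fun k => (hyz k).symm
    have hz0 : Delta A z = 0 := by
      refine eq_zero_of_mem_comp_add_one ?_ (Delta_mem g hz)
      rw [hc, Delta_add] at hDd
      simpa using sub_mem hDd (Delta_mem g hy)
    have : z = 0 := Delta_injective A (hz0.trans (Delta_zero A).symm)
    rw [hc, this, add_zero]
    exact hy k
  · have key : (fun k => (A k).str.inv.toLin (c k)) - (κ.sign : ℤ) • c = 0 := by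
      refine eq_zero_of_Delta_mem_V ?_
      rw [map_add, gamma_Delta] at hs
      have h1 : Delta A ((fun k => (A k).str.inv.toLin (c k)) - (κ.sign : ℤ) • c) =
          Delta A (fun k => (A k).str.inv.toLin (c k)) - (κ.sign : ℤ) • Delta A c := by
        have h2 := Delta_add A (fun k => (A k).str.inv.toLin (c k)) (((-κ.sign : ℤ) : F) • c)
        rw [Delta_smul] at h2
        rw [sub_eq_add_neg, ← neg_smul, ← Int.cast_smul_eq_zsmul F, h2,
          Int.cast_smul_eq_zsmul F, neg_smul, ← sub_eq_add_neg]
      rw [h1]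
      rw [smul_add] at hs
      have h3 : Delta A (fun k => (A k).str.inv.toLin (c k)) - (κ.sign : ℤ) • Delta A c =
          (κ.sign : ℤ) • v - (gamma A).toLin v := by
        exact sub_eq_sub_iff_add_eq_add.2 (hs.trans (add_comm _ _))
      rw [h3]
      exact sub_mem (zsmul_mem hv _) (gamma_V hv)
    exact sub_eq_zero.1 (congrFun key k)

/-! ### Generators of the homogeneous symmetric and skew components -/

/-- The element of `D` with a single nonzero component. -/
noncomputable def diagElt (A : Fin m → SimpleStar F) (k : Fin m) (c : (A k).Carrier) : alg A :=
  ⟨Delta A (Pi.single k c), _, 0, zero_mem _, (add_zero _).symm⟩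

/-- The matrix `e_{p,q} ± e_{q',p'}`. -/
noncomputable def unitPair (A : Fin m → SimpleStar F) (s : ℤˣ) (p q : Half A) : Amb A :=
  Matrix.single (Sum.inl p) (Sum.inl q) 1 +
    (s : ℤ) • Matrix.single (Sum.inr q) (Sum.inr p) 1

theorem unitPair_inl (A : Fin m → SimpleStar F) (s : ℤˣ) (p q p' q' : Half A) :
    unitPair A s p q (Sum.inl p') (Sum.inl q') = if p' = p ∧ q' = q then 1 else 0 := by
  simp [unitPair, Matrix.single_apply, eq_comm]

theorem unitPair_inr (A : Fin m → SimpleStar F) (s : ℤˣ) (p q p' q' : Half A) :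
    unitPair A s p q (Sum.inr q') (Sum.inr p') = if p' = p ∧ q' = q then ((s : ℤ) : F) else 0 := by
  simp [unitPair, Matrix.single_apply, eq_comm, and_comm]

theorem unitPair_mixed (A : Fin m → SimpleStar F) (s : ℤˣ) (p q p' q' : Half A) :
    unitPair A s p q (Sum.inl p') (Sum.inr q') = 0 ∧
      unitPair A s p q (Sum.inr p') (Sum.inl q') = 0 := by
  simp [unitPair]

theorem unitPair_mem_V (A : Fin m → SimpleStar F) (s : ℤˣ) {p q : Half A} (h : p.1 < q.1) :
    unitPair A s p q ∈ V A := by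
  rintro (p' | p') (q' | q') hpq
  · rw [unitPair_inl, if_neg]
    rintro ⟨rfl, rfl⟩
    exact hpq h
  · exact (unitPair_mixed ..).1
  · exact (unitPair_mixed ..).2
  · rw [unitPair_inr, if_neg]
    rintro ⟨rfl, rfl⟩
    exact hpq h

/-- The element `e_{p,q} ± e_{q',p'}` of `V`. -/
noncomputable def unitElt (A : Fin m → SimpleStar F) (s : ℤˣ) (p q : Half A) (h : p.1 < q.1) :
    alg A :=
  ⟨unitPair A s p q, 0, _, unitPair_mem_V A s h, by rw [Delta_zero, zero_add]⟩

theorem diagElt_mem_part {A : Fin m → SimpleStar F} (g : Fin m → ZMod 2) {κ : VarKind} {k : Fin m}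
    {c : (A k).Carrier} (hc : c ∈ (A k).str.part κ) : diagElt A k c ∈ (str A g).part κ := by
  have hc' := ((A k).str.mem_part κ c).1 hc
  rw [mem_part_iff]
  constructor
  · refine Delta_mem g fun l => ?_
    rcases eq_or_ne l k with rfl | h
    · simpa using hc'.1
    · rw [Pi.single_eq_of_ne h]; exact zero_mem _
  · change (gamma A).toLin (Delta A _) = (κ.sign : ℤ) • Delta A _
    rw [gamma_Delta, ← Int.cast_smul_eq_zsmul F, ← Delta_smul]
    congr 1
    funext l
    rcases eq_or_ne l k with rfl | h
    · simp [hc'.2, Int.cast_smul_eq_zsmul]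
    · simp [Pi.single_eq_of_ne h]

theorem unitElt_mem_part {A : Fin m → SimpleStar F} {g : Fin m → ZMod 2} {κ : VarKind}
    {p q : Half A} (h : p.1 < q.1)
    (hd : alpha A g (Sum.inl p) + alpha A g (Sum.inl q) = κ.deg) :
    unitElt A κ.sign p q h ∈ (str A g).part κ := by
  have hs : (κ.sign : ℤ) * (κ.sign : ℤ) = 1 := by
    rw [← Units.val_mul, Int.units_mul_self, Units.val_one]
  rw [mem_part_iff]
  constructor
  · rintro (p' | p') (q' | q') hpq
    · refine (unitPair_inl ..).trans (if_neg ?_)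
      rintro ⟨rfl, rfl⟩
      exact hpq hd
    · exact (unitPair_mixed ..).1
    · exact (unitPair_mixed ..).2
    · refine (unitPair_inr ..).trans (if_neg ?_)
      rintro ⟨rfl, rfl⟩
      exact hpq (by rw [add_comm]; exact hd)
  · have hs' : ((κ.sign : ℤ) : F) * ((κ.sign : ℤ) : F) = 1 := by
      rw [← Int.cast_mul, hs, Int.cast_one]
    change (gamma A).toLin (unitPair A κ.sign p q) = (κ.sign : ℤ) • unitPair A κ.sign p q
    ext (p' | p') (q' | q') <;> rw [gamma_apply, ← Int.cast_smul_eq_zsmul F, Matrix.smul_apply]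
    · simp only [Sum.swap_inl, unitPair_inl, unitPair_inr]
      split_ifs <;> simp
    · simp [(unitPair_mixed ..).1]
    · simp [(unitPair_mixed ..).2]
    · simp only [Sum.swap_inr, unitPair_inl, unitPair_inr, smul_eq_mul]
      split_ifs <;> simp [hs']

/-- The indices of a basis of `⨁ (A_k)ᵢ^±`. -/
abbrev DiagIdx (A : Fin m → SimpleStar F) (κ : VarKind) : Type := Σ k, Fin ((A k).dim κ)

/-- The positions of `V` in the first half that have the degree of `κ`. -/
abbrev UnitIdx (A : Fin m → SimpleStar F) (g : Fin m → ZMod 2) (κ : VarKind) : Type :=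
  {e : Half A × Half A //
    e.1.1 < e.2.1 ∧ alpha A g (Sum.inl e.1) + alpha A g (Sum.inl e.2) = κ.deg}

/-- A basis of `(A_k)ᵢ^±`. -/
noncomputable def blockBasis (A : Fin m → SimpleStar F) (κ : VarKind) (k : Fin m) :
    Module.Basis (Fin ((A k).dim κ)) F ((A k).str.part κ) :=
  Module.finBasis F ((A k).str.part κ)

/-- Generators of the component of kind `κ`. -/
noncomputable def gen (A : Fin m → SimpleStar F) (g : Fin m → ZMod 2) (κ : VarKind) :
    DiagIdx A κ ⊕ UnitIdx A g κ → alg A :=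
  Sum.elim (fun d => diagElt A d.1 (blockBasis A κ d.1 d.2))
    fun e => unitElt A κ.sign e.1.1 e.1.2 e.2.1

/-- The diagonal components lie in the components of kind κ of the blocks and expand in their bases.
The remaining part of `V` is symmetric or skew under the reflection, so its entries in the first
half are the coefficients of the unit pairs. -/
theorem mem_span_range_gen {A : Fin m → SimpleStar F} {g : Fin m → ZMod 2} {κ : VarKind}
    {x : alg A} (hx : x ∈ (str A g).part κ) : x ∈ Submodule.span F (Set.range (gen A g κ)) := by
  obtain ⟨X, c, v, hv, rfl⟩ := x
  obtain ⟨hd, hs⟩ := mem_part_iff.1 hx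
  dsimp only at hd hs
  have hc := mem_part_of_add_mem_part hv hd hs
  set S := Submodule.span F (Set.range (gen A g κ))
  suffices h : Delta A c + v ∈ S.map (alg A).val.toLinearMap by
    obtain ⟨y, hy, hyx⟩ := h
    have : y = ⟨Delta A c + v, ⟨c, v, hv, rfl⟩⟩ := Subtype.ext hyx
    exact this ▸ hy
  refine add_mem ?_ ?_
  · let DL : (∀ k, (A k).Carrier) →ₗ[F] Amb A :=
      { toFun := Delta A, map_add' := Delta_add A, map_smul' := Delta_smul A }
    have h1 : Delta A c = ∑ k, DL (Pi.single k (c k)) := by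
      rw [← map_sum, Finset.univ_sum_single]; rfl
    rw [h1]
    refine sum_mem fun k _ => ?_
    have h2 := (blockBasis A κ k).sum_repr ⟨c k, hc k⟩
    have h3 : c k = ∑ i, (blockBasis A κ k).repr ⟨c k, hc k⟩ i •
        (blockBasis A κ k i : (A k).Carrier) := by
      have := congrArg ((A k).str.part κ).subtype h2
      rw [map_sum] at this
      exact this.symm
    rw [h3]
    have h4 : ∀ y, DL (Pi.single k y) = (DL ∘ₗ LinearMap.single F _ k) y := fun _ => rfl
    rw [h4, map_sum]
    refine sum_mem fun i _ => ?_
    rw [map_smul]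
    exact Submodule.smul_mem _ _ ⟨gen A g κ (Sum.inl ⟨k, i⟩), Submodule.subset_span ⟨_, rfl⟩, rfl⟩
  · have hvs : (gamma A).toLin v = (κ.sign : ℤ) • v := by
      rw [map_add, gamma_Delta, smul_add, ← Int.cast_smul_eq_zsmul F _ (Delta A c),
        ← Delta_smul] at hs
      have : (fun k => (A k).str.inv.toLin (c k)) = ((κ.sign : ℤ) : F) • c := by
        funext k
        rw [(((A k).str.mem_part κ (c k)).1 (hc k)).2, Pi.smul_apply, Int.cast_smul_eq_zsmul]
      rw [this] at hs
      exact add_left_cancel hs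
    have hvr : ∀ p q, v (Sum.inr q) (Sum.inr p) =
        v (Sum.inl p) (Sum.inl q) * ((κ.sign : ℤ) : F) := by
      intro p q
      have := congrFun (congrFun hvs (Sum.inl p)) (Sum.inl q)
      rw [gamma_apply, ← Int.cast_smul_eq_zsmul F, Matrix.smul_apply, smul_eq_mul] at this
      rw [mul_comm]
      exact this
    have h1 : v = ∑ p, ∑ q, v (Sum.inl p) (Sum.inl q) • unitPair A κ.sign p q := by
      ext (p' | p') (q' | q') <;> simp only [Matrix.sum_apply, Matrix.smul_apply]
      · simp [unitPair_inl, ite_and]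
      · simp only [(unitPair_mixed ..).1, smul_zero, Finset.sum_const_zero]
        exact hv _ _ id
      · simp only [(unitPair_mixed ..).2, smul_zero, Finset.sum_const_zero]
        exact hv _ _ id
      · simp [unitPair_inr, ite_and, hvr]
    rw [h1]
    refine sum_mem fun p _ => sum_mem fun q _ => ?_
    by_cases hpq : p.1 < q.1
    · by_cases hdeg : alpha A g (Sum.inl p) + alpha A g (Sum.inl q) = κ.deg
      · exact Submodule.smul_mem _ _
          ⟨gen A g κ (Sum.inr ⟨(p, q), hpq, hdeg⟩), Submodule.subset_span ⟨_, rfl⟩, rfl⟩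
      · have h2 := hd (Sum.inl p) (Sum.inl q) hdeg
        rw [Matrix.add_apply, Delta_apply_of_not (p := Sum.inl p) (q := Sum.inl q) c hpq.ne,
          zero_add] at h2
        rw [h2, zero_smul]
        exact zero_mem _
    · rw [hv _ _ (show ¬ InV A (Sum.inl p) (Sum.inl q) from hpq), zero_smul]
      exact zero_mem _

end UT

/-! ### The upper bound -/

namespace UT

variable {F : Type u} [Field F] {m : ℕ}

/-- The block of a position. -/
def blk {A : Fin m → SimpleStar F} : Pos A → Fin m := Sum.elim Sigma.fst Sigma.fst

/-- The number of the block of a position, with a sign that makes it weakly increasing along the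
nonzero entries of elements of `UT∗`. -/
def height {A : Fin m → SimpleStar F} : Pos A → ℤ
  | Sum.inl p => (p.1 : ℕ)
  | Sum.inr p => -((p.1 : ℕ) : ℤ)

theorem sameBlock_or_inV {A : Fin m → SimpleStar F} (x : alg A) {p q : Pos A}
    (h : (x : Amb A) p q ≠ 0) : SameBlock A p q ∨ InV A p q := by
  obtain ⟨X, c, v, hv, rfl⟩ := x
  by_contra! hn
  refine h ?_
  change (Delta A c + v) p q = 0
  rw [Matrix.add_apply, Delta_apply_of_not c hn.1, hv p q hn.2, add_zero]

theorem isLeft_eq_and_height_le {A : Fin m → SimpleStar F} (x : alg A) {p q : Pos A}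
    (h : (x : Amb A) p q ≠ 0) : p.isLeft = q.isLeft ∧ height p ≤ height q := by
  rcases p with p | p <;> rcases q with q | q <;> rcases sameBlock_or_inV x h with h | h
  · simp [height, show p.1 = q.1 from h]
  · have : p.1 < q.1 := h
    simpa [height] using this.le
  · exact h.elim
  · exact h.elim
  · exact h.elim
  · exact h.elim
  · simp [height, show p.1 = q.1 from h]
  · have : q.1 < p.1 := h
    simpa [height] using this.le

/-- The first block that a generator involves. -/
def lo {A : Fin m → SimpleStar F} {g : Fin m → ZMod 2} {κ : VarKind} :
    DiagIdx A κ ⊕ UnitIdx A g κ → Fin m :=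
  Sum.elim Sigma.fst fun e => e.1.1.1

/-- The last block that a generator involves. -/
def hi {A : Fin m → SimpleStar F} {g : Fin m → ZMod 2} {κ : VarKind} :
    DiagIdx A κ ⊕ UnitIdx A g κ → Fin m :=
  Sum.elim Sigma.fst fun e => e.1.2.1

theorem diagElt_apply_ne_zero {A : Fin m → SimpleStar F} {k : Fin m} {c : (A k).Carrier}
    {p q : Pos A} (h : (diagElt A k c : Amb A) p q ≠ 0) : blk p = k ∧ blk q = k := by
  have hpq : SameBlock A p q := by
    by_contra hn
    exact h (Delta_apply_of_not _ hn)
  rcases p with ⟨l, p⟩ | ⟨l, p⟩ <;> rcases q with ⟨l', q⟩ | ⟨l', q⟩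
  · obtain rfl : l = l' := hpq
    suffices l = k from ⟨this, this⟩
    by_contra hl
    refine h ((Delta_inl A _ l p q).trans ?_)
    rw [Pi.single_eq_of_ne hl, map_zero, Matrix.zero_apply]
  · exact hpq.elim
  · exact hpq.elim
  · obtain rfl : l = l' := hpq
    suffices l = k from ⟨this, this⟩
    by_contra hl
    refine h ((Delta_inr A _ l p q).trans ?_)
    rw [Pi.single_eq_of_ne hl, map_zero, map_zero, Matrix.zero_apply]

/-- A generator occupies only one block position in each half. A path through it therefore climbs
exactly from `lo` to `hi`, or in the mirrored half from `-hi` to `-lo`. -/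
theorem gen_apply_ne_zero {A : Fin m → SimpleStar F} {g : Fin m → ZMod 2} {κ : VarKind}
    {e : DiagIdx A κ ⊕ UnitIdx A g κ} {p q : Pos A} (h : (gen A g κ e : Amb A) p q ≠ 0) :
    (p.isLeft → height p = (lo e : ℕ) ∧ height q = (hi e : ℕ)) ∧
      (p.isLeft = false → height p = -((hi e : ℕ) : ℤ) ∧ height q = -((lo e : ℕ) : ℤ)) := by
  rcases e with ⟨k, e⟩ | ⟨⟨a, b⟩, hab⟩
  · have hs := isLeft_eq_and_height_le _ h
    obtain ⟨hp, hq⟩ := diagElt_apply_ne_zero h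
    rcases p with p | p <;> rcases q with q | q <;>
      simp_all [height, lo, hi, blk]
  · rcases p with p | p <;> rcases q with q | q
    · have := (unitPair_inl A κ.sign a b p q).symm.trans_ne h
      simp only [ne_eq, ite_eq_right_iff, not_forall] at this
      obtain ⟨⟨rfl, rfl⟩, -⟩ := this
      simp [height, lo, hi]
    · exact absurd (unitPair_mixed ..).1 h
    · exact absurd (unitPair_mixed ..).2 h
    · have := (unitPair_inr A κ.sign a b q p).symm.trans_ne h
      simp only [ne_eq, ite_eq_right_iff, not_forall] at this
      obtain ⟨⟨rfl, rfl⟩, -⟩ := this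
      simp [height, lo, hi]

/-- The blocks involved in the factors of a nonzero product do not overlap. -/
theorem hi_le_lo_of_prod_ne_zero {A : Fin m → SimpleStar F} {g : Fin m → ZMod 2} {κ : VarKind}
    {n : ℕ} {e : Fin n → DiagIdx A κ ⊕ UnitIdx A g κ} {y : ℕ → alg A}
    (h : (List.ofFn fun i => gen A g κ (e i) * y i).prod ≠ 0) {i j : Fin n} (hij : i < j) :
    hi (e i) ≤ lo (e j) ∨ hi (e j) ≤ lo (e i) := by
  have h1 : (List.ofFn fun i => ((gen A g κ (e i) * y i : alg A) : Amb A)).prod ≠ 0 := by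
    intro h0
    refine h (Subtype.ext ?_)
    have : ((List.ofFn fun i => gen A g κ (e i) * y i).prod : alg A).1 =
        (alg A).val (List.ofFn fun i => gen A g κ (e i) * y i).prod := rfl
    rw [this, map_list_prod, List.map_ofFn]
    exact h0
  obtain ⟨p, q, hpq⟩ : ∃ p q,
      (List.ofFn fun i => ((gen A g κ (e i) * y i : alg A) : Amb A)).prod p q ≠ 0 := by
    by_contra! h0
    exact h1 (Matrix.ext h0)
  obtain ⟨r, hr0, hr⟩ := exists_path_of_list_prod_ne_zero n _ p q hpq
  -- The path cannot change halves and its height never decreases. Hence factor `i` has finished its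
  -- climb before the later factor `j` begins; which of the two intervals comes first depends on the
  -- half.
  have hstep : ∀ i : Fin n, (r i).isLeft = (r (i + 1)).isLeft ∧ height (r i) ≤ height (r (i + 1)) :=
    fun i => isLeft_eq_and_height_le _ (hr i)
  have hside : ∀ i, i ≤ n → (r i).isLeft = p.isLeft := by
    intro i
    induction i with
    | zero => exact fun _ => by rw [hr0]
    | succ i ih => exact fun hi => by rw [← ih (by omega), (hstep ⟨i, hi⟩).1]
  have hmono : ∀ i j, i ≤ j → j ≤ n → height (r i) ≤ height (r j) := by
    intro i j hij
    induction j, hij using Nat.le_induction with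
    | base => exact fun _ => le_rfl
    | succ j _ ih => exact fun hj => (ih (by omega)).trans (hstep ⟨j, hj⟩).2
  have hfac : ∀ i : Fin n, ∃ s, (gen A g κ (e i) : Amb A) (r i) s ≠ 0 ∧
      height s ≤ height (r (i + 1)) := by
    intro i
    have := hr i
    rw [MulMemClass.coe_mul, Matrix.mul_apply] at this
    obtain ⟨s, -, hs⟩ := Finset.exists_ne_zero_of_sum_ne_zero this
    exact ⟨s, left_ne_zero_of_mul hs, (isLeft_eq_and_height_le _ (right_ne_zero_of_mul hs)).2⟩
  obtain ⟨s, hs, hs'⟩ := hfac i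
  obtain ⟨s', hs1, -⟩ := hfac j
  have hm := hmono (i + 1) j hij j.2.le
  rcases hb : p.isLeft with - | -
  · right
    have h1 := (gen_apply_ne_zero hs).2 (by rw [hside i i.2.le, hb])
    have h2 := (gen_apply_ne_zero hs1).2 (by rw [hside j j.2.le, hb])
    rw [Fin.le_def]
    omega
  · left
    have h1 := (gen_apply_ne_zero hs).1 (by rw [hside i i.2.le, hb])
    have h2 := (gen_apply_ne_zero hs1).1 (by rw [hside j j.2.le, hb])
    rw [Fin.le_def]
    omega

/-- The pairs of consecutive blocks that are linked in degree `i`. -/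
abbrev LinkIdx (A : Fin m → SimpleStar F) (g : Fin m → ZMod 2) (i : ZMod 2) : Type :=
  {p : Fin m × Fin m // Linked A g i p.1 p.2}

/-- Twice the place of a basis element of a block, or of a link between two blocks. -/
def place {A : Fin m → SimpleStar F} {g : Fin m → ZMod 2} {κ : VarKind} :
    DiagIdx A κ ⊕ LinkIdx A g κ.deg → ℕ :=
  Sum.elim (fun d => 2 * d.1) fun l => 2 * l.1.1 + 1

/-- Each generator in `V` jumps over a link or over a nonzero component of a block. -/
theorem exists_place [CharZero F] {A : Fin m → SimpleStar F} {g : Fin m → ZMod 2} {κ : VarKind}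
    (hκ : κ = .evenSkew → ¬ Isolated A g) (e : UnitIdx A g κ) :
    ∃ w : DiagIdx A κ ⊕ LinkIdx A g κ.deg,
      2 * (e.1.1.1 : ℕ) < place w ∧ place w < 2 * (e.1.2.1 : ℕ) := by
  obtain ⟨⟨⟨a, p⟩, ⟨b, q⟩⟩, hab, hd⟩ := e
  change a < b at hab
  change ((A a).deg p + g a) + ((A b).deg q + g b) = κ.deg at hd
  -- Without a link in between, all blocks from `a` to `b` are trivially graded and all adjacent
  -- sums of `g` miss the wanted degree. The generator itself then shows that `a` and `b` are not
  -- adjacent, and the block right after `a` is the one to charge.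
  by_cases hL : ∃ k l, Linked A g κ.deg k l ∧ a ≤ k ∧ l ≤ b
  · obtain ⟨k, l, hkl, hak, hlb⟩ := hL
    have := hkl.1
    rw [Fin.le_def] at hak hlb
    refine ⟨Sum.inr ⟨(k, l), hkl⟩, ?_⟩
    simp only [place, Sum.elim_inr]
    omega
  push Not at hL
  rw [Fin.lt_def] at hab
  have hun : ∀ k l : Fin m, (k : ℕ) + 1 = l → a ≤ k → l ≤ b →
      (A k).IsTrivial ∧ (A l).IsTrivial ∧ g k + g l ≠ κ.deg := by
    intro k l hkl hak hlb
    have := fun h => hL k l h hak |>.not_ge hlb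
    rw [linked_iff] at this
    tauto
  have hne : (a : ℕ) + 1 ≠ b := fun h => (hL a b ⟨h, p, q, hd⟩ le_rfl).ne rfl
  let j : Fin m := ⟨a + 1, by omega⟩
  let k : Fin m := ⟨a + 2, by omega⟩
  have hj := hun a j rfl le_rfl (Fin.le_def.2 (by simp only [j]; omega))
  have hk := hun j k rfl (Fin.le_def.2 (by simp [j])) (Fin.le_def.2 (by simp only [k]; omega))
  have hdim : 0 < (A j).dim κ := by
    -- In odd degree, missing links would make `g` constant from `a` to `b`, so the generator would
    -- be even.
    have hodd : κ.deg ≠ 1 := by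
      intro h1
      rw [h1] at hun hd
      have hconst : ∀ l : ℕ, ∀ hl : l < m, (a : ℕ) ≤ l → l ≤ b →
          (A ⟨l, hl⟩).IsTrivial ∧ g ⟨l, hl⟩ = g a := by
        intro l hl hal
        induction l, hal using Nat.le_induction with
        | base => exact fun _ => ⟨hj.1, rfl⟩
        | succ l hal ih =>
          intro hlb
          obtain ⟨-, h2, h3⟩ := hun ⟨l, by omega⟩ ⟨l + 1, hl⟩ rfl (Fin.le_def.2 hal)
            (Fin.le_def.2 hlb)
          have h4 := (ih (by omega) (by omega)).2
          refine ⟨h2, ?_⟩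
          rw [← h4]
          generalize g ⟨l, _⟩ = x at h3 ⊢
          generalize g ⟨l + 1, _⟩ = z at h3 ⊢
          revert x z
          decide
      obtain ⟨hb, hgb⟩ := hconst b b.2 (by omega) le_rfl
      rw [SimpleStar.deg_eq_zero hj.1, SimpleStar.deg_eq_zero hb, zero_add, zero_add,
        show g b = g a from hgb, zmod_two_add_self] at hd
      exact absurd hd (by decide)
    cases κ with
    | evenSym => exact (A j).dim_evenSym_pos
    | evenSkew =>
      -- If block `j` were one-dimensional, then `a, j, k` would be an isolated configuration, since
      -- missing even links mean different values of `g`.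
      refine SimpleStar.dim_evenSkew_pos hj.2.1 fun h1 => hκ rfl
        ⟨a, j, k, rfl, rfl, hj.1, hj.2.1, hk.2.1, h1, ?_, ?_⟩
      · intro h; exact hj.2.2 (by rw [h]; exact zmod_two_add_self _)
      · intro h; exact hk.2.2 (by rw [h]; exact zmod_two_add_self _)
    | oddSym => exact absurd rfl hodd
    | oddSkew => exact absurd rfl hodd
  refine ⟨Sum.inl ⟨j, 0, hdim⟩, ?_⟩
  simp only [place, Sum.elim_inl, j]
  omega

/-- A product of more generators than there are basis elements of blocks and links vanishes. -/
theorem prod_gen_eq_zero [CharZero F] {A : Fin m → SimpleStar F} {g : Fin m → ZMod 2}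
    {κ : VarKind} (hκ : κ = .evenSkew → ¬ Isolated A g) {n : ℕ}
    (hn : dim A κ + numLinks A g κ.deg < n) {e : Fin n → DiagIdx A κ ⊕ UnitIdx A g κ}
    (he : Function.Injective e) (y : ℕ → alg A) :
    (List.ofFn fun i => gen A g κ (e i) * y i).prod = 0 := by
  by_contra h
  have hov : ∀ i j, i < j → hi (e i) ≤ lo (e j) ∨ hi (e j) ≤ lo (e i) :=
    fun i j => hi_le_lo_of_prod_ne_zero h
  choose w hw using exists_place (A := A) (g := g) (κ := κ) hκ
  -- A generator in `V` is charged to a place strictly inside its interval, and intervals do not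
  -- overlap. So two charges can coincide only for diagonal generators, which are distinct by
  -- assumption.
  let z : DiagIdx A κ ⊕ UnitIdx A g κ → DiagIdx A κ ⊕ LinkIdx A g κ.deg := Sum.elim Sum.inl w
  have hz : Function.Injective fun i => z (e i) := by
    suffices H : ∀ d d' : DiagIdx A κ ⊕ UnitIdx A g κ, d ≠ d' → hi d ≤ lo d' → z d ≠ z d' by
      intro i j hij
      by_contra hne
      have hd : e i ≠ e j := fun h => hne (he h)
      rcases lt_or_gt_of_ne hne with hlt | hlt
      · rcases hov _ _ hlt with h | h
        · exact H _ _ hd h hij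
        · exact H _ _ hd.symm h hij.symm
      · rcases hov _ _ hlt with h | h
        · exact H _ _ hd.symm h hij.symm
        · exact H _ _ hd h hij
    rintro (d | d) (d' | d') hne hle heq
    · exact hne (congrArg Sum.inl (Sum.inl_injective heq))
    · have h1 := (hw d').1
      rw [← (show Sum.inl d = w d' from heq)] at h1
      have : (d.1 : ℕ) ≤ d'.1.1.1 := hle
      simp only [place, Sum.elim_inl] at h1
      omega
    · have h1 := (hw d).2
      rw [show w d = Sum.inl d' from heq] at h1
      have : (d.1.2.1 : ℕ) ≤ d'.1 := hle
      simp only [place, Sum.elim_inl] at h1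
      omega
    · have h1 := (hw d).2
      have h2 := (hw d').1
      rw [show w d = w d' from heq] at h1
      have : (d.1.2.1 : ℕ) ≤ d'.1.1.1 := hle
      omega
  have hcard := Nat.card_le_card_of_injective _ hz
  rw [Nat.card_fin, Nat.card_sum, Nat.card_eq_fintype_card (α := DiagIdx A κ),
    Fintype.card_sigma] at hcard
  simp only [Fintype.card_fin] at hcard
  exact absurd hn (not_lt.2 hcard)

theorem capelliFull_eq_zero [CharZero F] {A : Fin m → SimpleStar F}
    {g : Fin m → ZMod 2} {κ : VarKind} (hκ : κ = .evenSkew → ¬ Isolated A g) {n : ℕ}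
    (hn : dim A κ + numLinks A g κ.deg < n) {e : Fin n → DiagIdx A κ ⊕ UnitIdx A g κ}
    (he : Function.Injective e) (y : ℕ → alg A) :
    capelliFull n (fun i => gen A g κ (e i)) y = 0 := by
  unfold capelliFull
  refine Finset.sum_eq_zero fun σ _ => ?_
  rw [prod_gen_eq_zero hκ hn (e := fun i => e (σ i)) (he.comp σ.injective) y, smul_zero]

/-- Alternation reduces to distinct generators, for which every single summand of the Capelli
expression already vanishes. -/
theorem gradedCapelli_subset_identities [CharZero F] {A : Fin m → SimpleStar F}
    {g : Fin m → ZMod 2} {κ : VarKind} (hκ : κ = .evenSkew → ¬ Isolated A g) {n : ℕ}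
    (hn : dim A κ + numLinks A g κ.deg < n) :
    gradedCapelli F κ n ⊆ (str A g).identities := by
  refine gradedCapelli_subset_of_capelli_eq_zero _ _ _ fun t x ht => ?_
  rw [capelli_eq_capelliFull, ← capelliFullAlt_apply (F := F)]
  refine AlternatingMap.eq_zero_of_span _ (gen A g κ) (fun e he => ?_) _
    fun i => mem_span_range_gen (ht i)
  exact (capelliFullAlt_apply (F := F) _ _ _).trans (capelliFull_eq_zero hκ hn he _)

end UT

/-! ### The lower bound -/

namespace UT

variable {F : Type u} [Field F] {m : ℕ}

/-- Some Capelli evaluation at the elements of the list has a nonzero row in the first half, in the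
block `k` or a later one. -/
def HasRow (A : Fin m → SimpleStar F) (g : Fin m → ZMod 2) (L : List (alg A)) (k : Fin m) : Prop :=
  ∃ p : Half A, k ≤ p.1 ∧ ∃ y : ℕ → alg A, (∀ j, ∃ κ, y j ∈ (str A g).part κ) ∧
    ∃ q, ((capelliFull L.length L.get y : alg A) : Amb A) (Sum.inl p) q ≠ 0

theorem HasRow.mono {A : Fin m → SimpleStar F} {g : Fin m → ZMod 2} {L : List (alg A)}
    {k l : Fin m} (h : HasRow A g L l) (hkl : k ≤ l) : HasRow A g L k := by
  obtain ⟨p, hp, hy⟩ := h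
  exact ⟨p, hkl.trans hp, hy⟩

theorem sum_mul_apply {A : Fin m → SimpleStar F} {ι : Type*} [Fintype ι] (x : ι → alg A)
    (G : alg A) (P : ι → Half A) (q : Pos A) :
    ∑ i, ((x i * G : alg A) : Amb A) (Sum.inl (P i)) q =
      ∑ r, (∑ i, (x i : Amb A) (Sum.inl (P i)) r) * (G : Amb A) r q := by
  simp only [MulMemClass.coe_mul, Matrix.mul_apply, Finset.sum_mul]
  exact Finset.sum_comm

/-- Rows of Capelli evaluations can be transported to longer lists by separating the new first
element from the remaining ones. -/
theorem exists_row_cons [CharZero F] {A : Fin m → SimpleStar F} {g : Fin m → ZMod 2}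
    {ι : Type*} [Fintype ι] (t : alg A) (L : List (alg A)) {p' : Half A} {y : ℕ → alg A}
    (hy : ∀ j, ∃ κ, y j ∈ (str A g).part κ) {q : Pos A}
    (h : ((capelliFull L.length L.get y : alg A) : Amb A) (Sum.inl p') q ≠ 0) (P : ι → Half A)
    (c : ι → alg A)
    (h1 : ∀ r, ∑ i, ((t * c i : alg A) : Amb A) (Sum.inl (P i)) r =
      if r = Sum.inl p' then 1 else 0)
    (h2 : ∀ s ∈ L, ∀ r, ∑ i, ((s * c i : alg A) : Amb A) (Sum.inl (P i)) r = 0) :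
    ∃ i, ∃ y' : ℕ → alg A, (∀ j, ∃ κ, y' j ∈ (str A g).part κ) ∧ ∃ q,
      ((capelliFull (t :: L).length (t :: L).get y' : alg A) : Amb A) (Sum.inl (P i)) q ≠ 0 := by
  -- The new intermediate element `b` goes into slot 0 and the old ones are shifted by one. The
  -- expression is additive in `b`.
  let Y : alg A → ℕ → alg A := fun b j => Nat.casesOn j b y
  let G : Fin (L.length + 1) → alg A := fun j =>
    capelliFull L.length (fun i => (t :: L).get (Equiv.swap 0 j i.succ)) y
  have hW : ∀ b, capelliFull (t :: L).length (t :: L).get (Y b) =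
      ∑ j : Fin (L.length + 1), (if j = 0 then 1 else -1 : ℤ) • ((t :: L).get j * b * G j) :=
    fun b => capelliFull_succ _ _ _
  let Φ : ι → alg A → F := fun i b =>
    ((capelliFull (t :: L).length (t :: L).get (Y b) : alg A) : Amb A) (Sum.inl (P i)) q
  have hadd : ∀ i a b, Φ i (a + b) = Φ i a + Φ i b := by
    intro i a b
    simp only [Φ]
    rw [hW, hW, hW, ← Matrix.add_apply, ← AddMemClass.coe_add, ← Finset.sum_add_distrib]
    simp only [mul_add, add_mul, smul_add]
  -- In the expansion along the first factor, the terms starting with an element of `L` cancel in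
  -- the row sum by `h2`. The term starting with `t` reproduces row `p'` of the old expression by
  -- `h1`.
  have hsum : ∑ i, Φ i (c i) ≠ 0 := by
    have hj : ∀ j : Fin (L.length + 1),
        ∑ i, (((t :: L).get j * c i * G j : alg A) : Amb A) (Sum.inl (P i)) q =
          if j = 0 then ((capelliFull L.length L.get y : alg A) : Amb A) (Sum.inl p') q else 0 := by
      intro j
      rw [sum_mul_apply]
      refine Fin.cases ?_ (fun j => ?_) j
      · have : G 0 = capelliFull L.length L.get y := by
          simp only [G, Equiv.swap_self]
          rfl
        simp only [List.get_cons_zero, h1, this, if_true]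
        simp
      · rw [if_neg (Fin.succ_ne_zero j)]
        refine Finset.sum_eq_zero fun r _ => ?_
        rw [List.get_cons_succ', h2 _ (List.get_mem _ _), zero_mul]
    have : ∑ i, Φ i (c i) = ((capelliFull L.length L.get y : alg A) : Amb A) (Sum.inl p') q := by
      have hΦ : ∀ i, Φ i (c i) = ∑ j : Fin (L.length + 1), (if j = 0 then 1 else -1 : ℤ) •
          (((t :: L).get j * c i * G j : alg A) : Amb A) (Sum.inl (P i)) q := by
        intro i
        simp only [Φ]
        rw [hW, AddSubmonoidClass.coe_finsetSum, Matrix.sum_apply]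
        rfl
      simp only [hΦ]
      rw [Finset.sum_comm]
      simp only [← Finset.smul_sum, hj]
      rw [Finset.sum_eq_single 0 (fun j _ hj => by rw [if_neg hj, if_neg hj, smul_zero])
        (fun h => absurd (Finset.mem_univ _) h)]
      simp
    rwa [this]
  obtain ⟨i, -, hi⟩ := Finset.exists_ne_zero_of_sum_ne_zero hsum
  have key : ∀ κ, ∀ b ∈ (str A g).part κ, Φ i b ≠ 0 → ∃ i, ∃ y' : ℕ → alg A,
      (∀ j, ∃ κ, y' j ∈ (str A g).part κ) ∧ ∃ q,
        ((capelliFull (t :: L).length (t :: L).get y' : alg A) : Amb A) (Sum.inl (P i)) q ≠ 0 := by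
    intro κ b hb hΦ
    refine ⟨i, Y b, fun j => ?_, q, hΦ⟩
    cases j with
    | zero => exact ⟨κ, hb⟩
    | succ j => exact hy j
  -- The separating element `c i` need not be homogeneous, symmetric or skew; by additivity one of
  -- its four components already gives a nonzero value.
  obtain ⟨a₀, h₀, a₁, h₁, a₂, h₂, a₃, h₃, hc⟩ := (str A g).sum_part (c i)
  by_contra hno
  have hz : ∀ κ, ∀ b ∈ (str A g).part κ, Φ i b = 0 := fun κ b hb => by
    by_contra hΦ
    exact hno (key κ b hb hΦ)
  exact hi (by rw [hc, hadd, hadd, hadd, hz _ _ h₀, hz _ _ h₁, hz _ _ h₂, hz _ _ h₃]; simp)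

/-- Some element of `UT∗` moves a given row to another given one in the same or a later block. -/
theorem exists_mem_alg_row_eq (A : Fin m → SimpleStar F) {p p' : Half A} (h : p.1 ≤ p'.1) :
    ∃ b : alg A, ∀ q, (b : Amb A) (Sum.inl p) q = if q = Sum.inl p' then 1 else 0 := by
  rcases h.lt_or_eq with h | h
  · refine ⟨unitElt A 1 p p' h, ?_⟩
    rintro (q | q)
    · exact (unitPair_inl ..).trans (by simp)
    · exact (unitPair_mixed ..).1.trans (by simp)
  · obtain ⟨k, p⟩ := p
    obtain ⟨l, p'⟩ := p'
    obtain rfl : k = l := h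
    obtain ⟨c, hc⟩ := (A k).exists_row_eq p p'
    refine ⟨diagElt A k c, ?_⟩
    rintro (⟨l, q⟩ | q)
    · by_cases hl : k = l
      · subst hl
        refine (Delta_inl A _ k p q).trans ?_
        simp [hc]
      · refine (Delta_apply_of_not _ (show ¬ SameBlock A (Sum.inl ⟨k, p⟩) (Sum.inl ⟨l, q⟩)
          from hl)).trans (if_neg fun h => hl ?_).symm
        exact (congrArg Sigma.fst (Sum.inl_injective h)).symm
    · exact (Delta_apply_of_not _ id).trans (by simp)

theorem diagElt_mul_diagElt (A : Fin m → SimpleStar F) (k : Fin m) (a b : (A k).Carrier) :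
    diagElt A k a * diagElt A k b = diagElt A k (a * b) :=
  Subtype.ext ((Delta_mul A _ _).symm.trans (congrArg (Delta A) (Pi.single_mul ..).symm))

theorem mul_diagElt_apply_eq_zero {A : Fin m → SimpleStar F} {k : Fin m} {s : alg A}
    (hs : ∀ p q, (s : Amb A) (Sum.inl ⟨k, p⟩) (Sum.inl ⟨k, q⟩) = 0) (c : (A k).Carrier)
    (p : (A k).Idx) (r : Pos A) :
    ((s * diagElt A k c : alg A) : Amb A) (Sum.inl ⟨k, p⟩) r = 0 := by
  rw [MulMemClass.coe_mul, Matrix.mul_apply]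
  refine Finset.sum_eq_zero fun x _ => ?_
  by_contra hx
  have h1 := (diagElt_apply_ne_zero (right_ne_zero_of_mul hx)).1
  have h2 := (isLeft_eq_and_height_le s (left_ne_zero_of_mul hx)).1
  rcases x with ⟨l, x⟩ | x
  · obtain rfl : l = k := h1
    exact left_ne_zero_of_mul hx (hs _ _)
  · simp at h2

/-- Basis elements are put in front one at a time. Separating elements of block `k` kill the basis
elements that are already there, and also kill `L`, which by `hL` has no entries in that diagonal
block; the factor `b` then moves the surviving row to the row known to be nonzero. -/
theorem HasRow.diag_append [CharZero F] {A : Fin m → SimpleStar F} {g : Fin m → ZMod 2}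
    {κ : VarKind} {k : Fin m} {L : List (alg A)} (h : HasRow A g L k)
    (hL : ∀ s ∈ L, ∀ p q, (s : Amb A) (Sum.inl ⟨k, p⟩) (Sum.inl ⟨k, q⟩) = 0)
    (l : List (Fin ((A k).dim κ))) (hl : l.Nodup) :
    HasRow A g (l.map (fun j => gen A g κ (Sum.inl ⟨k, j⟩)) ++ L) k := by
  induction l with
  | nil => exact h
  | cons j l ih =>
    rw [List.nodup_cons] at hl
    obtain ⟨p', hp', y, hy, q, hq⟩ := ih hl.2
    have hli : LinearIndependent F fun i => (blockBasis A κ k i : (A k).Carrier) :=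
      (blockBasis A κ k).linearIndependent.map' ((A k).str.part κ).subtype
        (Submodule.ker_subtype _)
    obtain ⟨p₀, hsep⟩ := (A k).exists_separation κ
      (t := fun i => (blockBasis A κ k i : (A k).Carrier)) (fun i => (blockBasis A κ k i).2) hli
    obtain ⟨c, hc⟩ := hsep j
    obtain ⟨b, hb⟩ := exists_mem_alg_row_eq A (p := ⟨k, p₀⟩) hp'
    have hrow : ∀ i r, ∑ p, ((gen A g κ (Sum.inl ⟨k, i⟩) * (diagElt A k (c p) * b) : alg A) :
        Amb A) (Sum.inl ⟨k, p⟩) r = if i = j ∧ r = Sum.inl p' then 1 else 0 := by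
      intro i r
      simp only [← mul_assoc]
      rw [sum_mul_apply _ _ fun p => ⟨k, p⟩]
      have h1 : ∀ x : Pos A, ∑ p, ((gen A g κ (Sum.inl ⟨k, i⟩) * diagElt A k (c p) : alg A) :
          Amb A) (Sum.inl ⟨k, p⟩) x = if i = j ∧ x = Sum.inl ⟨k, p₀⟩ then 1 else 0 := by
        have h2 : ∀ p, gen A g κ (Sum.inl ⟨k, i⟩) * diagElt A k (c p) =
          diagElt A k (blockBasis A κ k i * c p) := fun p => diagElt_mul_diagElt ..
        simp only [h2]
        rintro (⟨l, x⟩ | x)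
        · by_cases hkl : k = l
          · subst hkl
            have h3 : ∀ p, (diagElt A k (blockBasis A κ k i * c p) : Amb A) (Sum.inl ⟨k, p⟩)
                (Sum.inl ⟨k, x⟩) = ((A k).top (blockBasis A κ k i) * (A k).top (c p)) p x := by
              intro p
              refine (Delta_inl A _ k p x).trans ?_
              rw [Pi.single_eq_same, map_mul]
            simp only [h3]
            refine (hc i x).trans ?_
            simp
          · rw [if_neg]
            · exact Finset.sum_eq_zero fun p _ => Delta_apply_of_not _ hkl
            · rintro ⟨-, h⟩
              exact hkl (congrArg Sigma.fst (Sum.inl_injective h)).symm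
        · rw [if_neg (by simp)]
          exact Finset.sum_eq_zero fun p _ => Delta_apply_of_not _ id
      simp only [h1]
      by_cases hij : i = j
      · simp [hij, hb]
      · simp [hij]
    obtain ⟨p, y', hy', hq'⟩ := exists_row_cons (gen A g κ (Sum.inl ⟨k, j⟩)) _ hy hq
      (fun p => ⟨k, p⟩) (fun p => diagElt A k (c p) * b) (fun r => by simpa using hrow j r)
      (fun s hs r => by
        rcases List.mem_append.1 hs with hs | hs
        · obtain ⟨i, hi, rfl⟩ := List.mem_map.1 hs
          rw [hrow i r, if_neg]
          rintro ⟨rfl, -⟩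
          exact hl.1 hi
        · simp only [← mul_assoc]
          rw [sum_mul_apply _ _ fun p => ⟨k, p⟩]
          simp [mul_diagElt_apply_eq_zero (hL s hs)])
    exact ⟨⟨k, p⟩, le_rfl, y', hy', hq'⟩

/-- No summation is needed here: by `hL` only the new element has a nonzero row `p`, and this row is
the unit vector at `q`, from where later blocks can be reached. -/
theorem HasRow.unitElt_cons [CharZero F] {A : Fin m → SimpleStar F} {g : Fin m → ZMod 2}
    {L : List (alg A)} (s : ℤˣ) {p q : Half A} (hpq : p.1 < q.1) (h : HasRow A g L q.1)
    (hL : ∀ x ∈ L, ∀ p' r, p'.1 = p.1 → (x : Amb A) (Sum.inl p') r = 0) :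
    HasRow A g (unitElt A s p q hpq :: L) p.1 := by
  obtain ⟨p', hp', y, hy, r, hr⟩ := h
  obtain ⟨b, hb⟩ := exists_mem_alg_row_eq A hp'
  obtain ⟨-, y', hy', hq'⟩ := exists_row_cons (unitElt A s p q hpq) L hy hr
    (fun _ : Unit => p) (fun _ => b)
    (fun r => by
      rw [Fintype.sum_unique, MulMemClass.coe_mul, Matrix.mul_apply, Fintype.sum_sum_type,
        ← hb r]
      have h1 : ∀ x, (unitElt A s p q hpq : Amb A) (Sum.inl p) (Sum.inl x) =
        if p = p ∧ x = q then 1 else 0 := fun x => unitPair_inl ..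
      have h2 : ∀ x, (unitElt A s p q hpq : Amb A) (Sum.inl p) (Sum.inr x) = 0 :=
        fun x => (unitPair_mixed ..).1
      simp [h1, h2])
    (fun x hx r => by
      rw [Fintype.sum_unique, MulMemClass.coe_mul, Matrix.mul_apply]
      exact Finset.sum_eq_zero fun z _ => by rw [hL x hx p z rfl, zero_mul])
  exact ⟨p, le_rfl, y', hy', hq'⟩

/-- A list with at most one element, which realizes the link from the block `k` to the next one. -/
theorem exists_linkList (A : Fin m → SimpleStar F) (g : Fin m → ZMod 2) (κ : VarKind)
    (k : Fin m) [Decidable (∃ l, Linked A g κ.deg k l)] :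
    ∃ J : List (alg A), (∀ x ∈ J, x ∈ (str A g).part κ) ∧
      J.length = (if ∃ l, Linked A g κ.deg k l then 1 else 0) ∧
      (J = [] ∨ ∃ p q, ∃ h : p.1 < q.1, p.1 = k ∧ (k : ℕ) + 1 = q.1 ∧
        J = [unitElt A κ.sign p q h]) := by
  split_ifs with h
  · obtain ⟨l, hkl, p, q, hd⟩ := h
    have hlt : k < l := Fin.lt_def.2 (by omega)
    refine ⟨[unitElt A κ.sign ⟨k, p⟩ ⟨l, q⟩ hlt], fun x hx => ?_, rfl,
      Or.inr ⟨⟨k, p⟩, ⟨l, q⟩, hlt, rfl, hkl, rfl⟩⟩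
    rw [List.mem_singleton] at hx
    subst hx
    exact unitElt_mem_part hlt hd
  · exact ⟨[], by simp, rfl, Or.inl rfl⟩

/-- The list is nested by blocks: the elements of each `B k` have nonzero rows in the first half
only in block `k`, so the later part of the list does not interfere when `B k` is put in front. -/
theorem exists_list_hasRow [CharZero F] (A : Fin m → SimpleStar F) (g : Fin m → ZMod 2)
    (κ : VarKind) (hm : 0 < m) :
    ∃ L : List (alg A), (∀ x ∈ L, x ∈ (str A g).part κ) ∧
      L.length = dim A κ + numLinks A g κ.deg ∧ ∃ k, HasRow A g L k := by
  classical
  choose J hJ hJlen hJform using fun k => exists_linkList A g κ k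
  let B : Fin m → List (alg A) := fun k =>
    (List.finRange ((A k).dim κ)).map (fun j => gen A g κ (Sum.inl ⟨k, j⟩)) ++ J k
  -- A link element avoids the diagonal block `k`, as `HasRow.diag_append` requires, and in the
  -- first half it avoids all rows outside block `k`, as `HasRow.unitElt_cons` requires.
  have hunit : ∀ k, ∀ x ∈ J k, ∀ (p' : Half A) r, (p'.1 = k → ∀ r', r = Sum.inl r' → r'.1 = k →
      (x : Amb A) (Sum.inl p') r = 0) ∧ (p'.1 ≠ k → (x : Amb A) (Sum.inl p') r = 0) := by
    intro k x hx p' r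
    rcases hJform k with h | ⟨p, q, hpq, hp, hq, h⟩
    · simp [h] at hx
    · rw [h, List.mem_singleton] at hx
      subst hx
      constructor
      · rintro hp' r' rfl hr'
        refine (unitPair_inl ..).trans (if_neg ?_)
        rintro ⟨rfl, rfl⟩
        exact hpq.ne (hp.trans hr'.symm)
      · intro hp'
        rcases r with r | r
        · refine (unitPair_inl ..).trans (if_neg ?_)
          rintro ⟨rfl, rfl⟩
          exact hp' hp
        · exact (unitPair_mixed ..).1
  have hrow : ∀ k, ∀ x ∈ B k, ∀ (p' : Half A) r, p'.1 ≠ k → (x : Amb A) (Sum.inl p') r = 0 := by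
    intro k x hx p' r hp'
    rcases List.mem_append.1 hx with hx | hx
    · obtain ⟨j, -, rfl⟩ := List.mem_map.1 hx
      by_contra h
      exact hp' (diagElt_apply_ne_zero h).1
    · exact (hunit k x hx p' r).2 hp'
  have main : ∀ ks : List (Fin m), ks.Pairwise (· < ·) → ∀ k, (∀ k' ∈ ks, k ≤ k') →
      HasRow A g (ks.flatMap B) k := by
    intro ks
    induction ks with
    | nil =>
      intro _ k _
      refine ⟨⟨k, Sum.inl ⟨0, (A k).evenSize_pos⟩⟩, le_rfl, 0, fun j => ⟨.evenSym, zero_mem _⟩,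
        Sum.inl ⟨k, Sum.inl ⟨0, (A k).evenSize_pos⟩⟩, ?_⟩
      have : capelliFull (List.flatMap B []).length (List.flatMap B []).get 0 = 1 :=
        capelliFull_zero _ _
      rw [this]
      simp
    | cons j ks ih =>
      intro hks k hk
      rw [List.pairwise_cons] at hks
      have hrest : ∀ x ∈ ks.flatMap B, ∀ (p' : Half A) r, p'.1 = j →
          (x : Amb A) (Sum.inl p') r = 0 := by
        intro x hx p' r hp'
        obtain ⟨l, hl, hx⟩ := List.mem_flatMap.1 hx
        exact hrow l x hx p' r (hp'.trans_ne (hks.1 l hl).ne)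
      refine HasRow.mono (l := j) ?_ (hk j List.mem_cons_self)
      rw [List.flatMap_cons, List.append_assoc]
      refine HasRow.diag_append ?_ (fun s hs p q => ?_) _ (List.nodup_finRange _)
      · rcases hJform j with h | ⟨p, q, hpq, rfl, hq, h⟩
        · rw [h, List.nil_append]
          exact ih hks.2 j fun k' hk' => (hks.1 k' hk').le
        · rw [h, List.singleton_append]
          refine HasRow.unitElt_cons _ hpq (ih hks.2 _ fun k' hk' => ?_) hrest
          have := hks.1 k' hk'
          rw [Fin.lt_def] at this
          rw [Fin.le_def]
          omega
      · rcases List.mem_append.1 hs with hs | hs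
        · exact (hunit j s hs ⟨j, p⟩ _).1 rfl _ rfl rfl
        · exact hrest s hs ⟨j, p⟩ _ rfl
  refine ⟨(List.finRange m).flatMap B, fun x hx => ?_, ?_, ⟨0, hm⟩,
    main _ (List.pairwise_lt_finRange m) _ fun k' _ => Fin.le_def.2 (Nat.zero_le _)⟩
  · obtain ⟨k, -, hx⟩ := List.mem_flatMap.1 hx
    rcases List.mem_append.1 hx with hx | hx
    · obtain ⟨j, -, rfl⟩ := List.mem_map.1 hx
      exact diagElt_mem_part g (blockBasis A κ k j).2
    · exact hJ k x hx
  -- A link is determined by its first block, so counting blocks with a link counts the links.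
  · rw [List.length_flatMap, ← Fin.sum_univ_def]
    simp only [B, List.length_append, List.length_map, List.length_finRange, hJlen,
      Finset.sum_add_distrib]
    congr 1
    rw [← Finset.card_filter, numLinks, ← Set.ncard_coe_finset]
    symm
    refine Set.ncard_congr (fun p _ => p.1) ?_ ?_ ?_
    · rintro ⟨k, l⟩ h
      simpa using ⟨l, h⟩
    · rintro ⟨k, l⟩ ⟨k', l'⟩ ⟨h, -⟩ ⟨h', -⟩ hkk
      obtain rfl : k = k' := hkk
      exact Prod.ext rfl (Fin.ext (h.symm.trans h'))
    · intro k hk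
      obtain ⟨l, hl⟩ := (Finset.mem_filter.1 (Finset.mem_coe.1 hk)).2
      exact ⟨(k, l), hl, rfl⟩

theorem lt_of_gradedCapelli_subset_identities [CharZero F] {A : Fin m → SimpleStar F}
    {g : Fin m → ZMod 2} {κ : VarKind} (hm : 0 < m) {n : ℕ} (hn : 0 < n)
    (h : gradedCapelli F κ n ⊆ (str A g).identities) : dim A κ + numLinks A g κ.deg < n := by
  by_contra! hle
  obtain ⟨L, hL, hlen, k, p, -, y, hy, q, hq⟩ := exists_list_hasRow A g κ hm
  rw [← hlen] at hle
  refine hq ?_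
  rw [capelliFull_eq_zero_of_le hn hle h _ y (fun i => hL _ (List.get_mem _ _)) hy]
  rfl

end UT

/-! ### Counting links and strings -/

namespace UT

variable {F : Type u} [Field F] {m : ℕ}

theorem ncard_succ_pairs (m : ℕ) : {p : Fin m × Fin m | (p.1 : ℕ) + 1 = p.2}.ncard = m - 1 := by
  rw [← Set.InjOn.ncard_image (f := fun p : Fin m × Fin m => (p.1 : ℕ))]
  · have : (fun p : Fin m × Fin m => (p.1 : ℕ)) '' {p | (p.1 : ℕ) + 1 = p.2} =
        (Finset.range (m - 1) : Set ℕ) := by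
      ext k
      simp only [Set.mem_image, Set.mem_ofPred_eq, Finset.coe_range, Set.mem_Iio]
      constructor
      · rintro ⟨⟨a, b⟩, h, rfl⟩
        dsimp only at h ⊢
        omega
      · exact fun hk => ⟨(⟨k, by omega⟩, ⟨k + 1, by omega⟩), rfl, rfl⟩
    rw [this, Set.ncard_coe_finset, Finset.card_range]
  · rintro ⟨a, b⟩ h ⟨a', b'⟩ h' hab
    have h : (a : ℕ) + 1 = b := h
    have h' : (a' : ℕ) + 1 = b' := h'
    dsimp only at hab
    exact Prod.ext (Fin.ext hab) (Fin.ext (by dsimp only; omega))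

theorem zmod_two_add_eq_zero_iff (x y : ZMod 2) : x + y = 0 ↔ x = y := by
  revert x y; decide

theorem zmod_two_add_eq_one_iff (x y : ZMod 2) : x + y = 1 ↔ x ≠ y := by
  revert x y; decide

/-- The `m - 1` adjacent pairs split into those linked in degree 0 and those trivially graded on
both sides with different values of `g`. -/
theorem numLinks_zero_add_r1 (A : Fin m → SimpleStar F) (g : Fin m → ZMod 2) :
    numLinks A g 0 + r1 A g = m - 1 := by
  rw [← ncard_succ_pairs, numLinks, r1, ← Set.ncard_union_eq]
  · congr 1
    ext p
    simp only [Set.mem_union, Set.mem_ofPred_eq, linked_iff, zmod_two_add_eq_zero_iff]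
    tauto
  · refine Set.disjoint_left.2 fun p hp hp' => ?_
    simp only [Set.mem_ofPred_eq, linked_iff, zmod_two_add_eq_zero_iff] at hp hp'
    tauto

theorem numLinks_one_add_r0 (A : Fin m → SimpleStar F) (g : Fin m → ZMod 2) :
    numLinks A g 1 + r0 A g = m - 1 := by
  rw [← ncard_succ_pairs, numLinks, r0, ← Set.ncard_union_eq]
  · congr 1
    ext p
    simp only [Set.mem_union, Set.mem_ofPred_eq, linked_iff, zmod_two_add_eq_one_iff]
    tauto
  · refine Set.disjoint_left.2 fun p hp hp' => ?_
    simp only [Set.mem_ofPred_eq, linked_iff, zmod_two_add_eq_one_iff] at hp hp'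
    tauto

/-- A trivially graded block either starts a string or is the second member of exactly one adjacent
pair of trivially graded blocks. -/
theorem r0_add_r1_add_numStrings (A : Fin m → SimpleStar F) (g : Fin m → ZMod 2) :
    r0 A g + r1 A g + numStrings A = numTrivial A := by
  have h1 : r0 A g + r1 A g = {p : Fin m × Fin m | (p.1 : ℕ) + 1 = p.2 ∧ (A p.1).IsTrivial ∧
      (A p.2).IsTrivial}.ncard := by
    rw [r0, r1, ← Set.ncard_union_eq]
    · congr 1
      ext p
      simp only [Set.mem_union, Set.mem_ofPred_eq]
      tauto
    · refine Set.disjoint_left.2 fun p hp hp' => ?_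
      simp only [Set.mem_ofPred_eq] at hp hp'
      tauto
  rw [h1, ← Set.InjOn.ncard_image (f := Prod.snd), numStrings, ← Set.ncard_union_eq]
  · rw [numTrivial]
    congr 1
    ext k
    simp only [Set.mem_union, Set.mem_image, Set.mem_ofPred_eq]
    constructor
    · rintro (⟨p, hp, rfl⟩ | h)
      · exact hp.2.2
      · exact h.1
    · intro hk
      by_cases h : ∀ j : Fin m, (j : ℕ) + 1 = k → ¬ (A j).IsTrivial
      · exact Or.inr ⟨hk, h⟩
      · push Not at h
        obtain ⟨j, hj, hj'⟩ := h
        exact Or.inl ⟨(j, k), ⟨hj, hj', hk⟩, rfl⟩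
  · refine Set.disjoint_left.2 ?_
    rintro _ ⟨p, hp, rfl⟩ h
    exact h.2 p.1 hp.1 hp.2.1
  · rintro ⟨a, b⟩ h ⟨a', b'⟩ h' hab
    have h := h.1
    have h' := h'.1
    dsimp only at h h' hab
    subst hab
    exact Prod.ext (Fin.ext (by dsimp only; omega)) rfl

theorem numStrings_pos {A : Fin m → SimpleStar F} (h : 0 < numTrivial A) : 0 < numStrings A := by
  obtain ⟨k, hk⟩ := (Set.ncard_pos (Set.toFinite _)).1 h
  obtain ⟨k, hk, hmin⟩ := WellFounded.has_min (wellFounded_lt (α := Fin m)) _ ⟨k, hk⟩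
  refine (Set.ncard_pos (Set.toFinite _)).2 ⟨k, hk, fun j hj hT => hmin j hT ?_⟩
  exact Fin.lt_def.2 (by omega)

theorem numTrivial_le (A : Fin m → SimpleStar F) : numTrivial A ≤ m := by
  simpa [numTrivial] using Set.ncard_le_card {k | (A k).IsTrivial}

theorem not_isolated_of_numTrivial_eq_zero {A : Fin m → SimpleStar F} (g : Fin m → ZMod 2)
    (h : numTrivial A = 0) : ¬ Isolated A g := by
  rintro ⟨i, -, -, -, -, hi, -⟩
  exact Set.eq_empty_iff_forall_notMem.1 ((Set.ncard_eq_zero (Set.toFinite _)).1 h) i hi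

theorem gradedCapelli_subset_identities_iff [CharZero F] {A : Fin m → SimpleStar F}
    {g : Fin m → ZMod 2} {κ : VarKind} (hm : 0 < m) (hκ : κ = .evenSkew → ¬ Isolated A g) {n : ℕ}
    (hn : 0 < n) :
    gradedCapelli F κ n ⊆ (str A g).identities ↔ dim A κ + numLinks A g κ.deg < n :=
  ⟨lt_of_gradedCapelli_subset_identities hm hn, gradedCapelli_subset_identities hκ⟩

end UT

/-! ### The thresholds in terms of strings and pairs of trivially graded blocks -/

theorem mainTheorem6 (F : Type u) [Field F] [IsAlgClosed F] [CharZero F] (m : ℕ)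
    (A : Fin m → SimpleStar F) (g : Fin m → ZMod 2) :
    (UT.numTrivial A = 0 →
      ∀ qp qm kp km : ℕ, 0 < qp → 0 < qm → 0 < kp → 0 < km →
        ((gradedCapelli F .evenSym qp ⊆ (UT.str A g).identities ∧
          gradedCapelli F .evenSkew qm ⊆ (UT.str A g).identities ∧
          gradedCapelli F .oddSym kp ⊆ (UT.str A g).identities ∧
          gradedCapelli F .oddSkew km ⊆ (UT.str A g).identities) ↔
        (qp ≥ UT.dim A .evenSym + m ∧ qm ≥ UT.dim A .evenSkew + m ∧
          kp ≥ UT.dim A .oddSym + m ∧ km ≥ UT.dim A .oddSkew + m))) ∧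
    (0 < UT.numTrivial A →
      UT.r0 A g + UT.r1 A g = UT.numTrivial A - UT.numStrings A ∧
      ∀ qp qm kp km : ℕ, 0 < qp → 0 < qm → 0 < kp → 0 < km →
        (¬ UT.Isolated A g →
          ((gradedCapelli F .evenSym qp ⊆ (UT.str A g).identities ∧
            gradedCapelli F .evenSkew qm ⊆ (UT.str A g).identities ∧
            gradedCapelli F .oddSym kp ⊆ (UT.str A g).identities ∧
            gradedCapelli F .oddSkew km ⊆ (UT.str A g).identities) ↔
          (qp > UT.dim A .evenSym + (m - UT.numTrivial A) + (UT.numStrings A - 1) + UT.r0 A g ∧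
            qm > UT.dim A .evenSkew + (m - UT.numTrivial A) + (UT.numStrings A - 1) + UT.r0 A g ∧
            kp > UT.dim A .oddSym + (m - UT.numTrivial A) + (UT.numStrings A - 1) + UT.r1 A g ∧
            km > UT.dim A .oddSkew + (m - UT.numTrivial A) + (UT.numStrings A - 1)
              + UT.r1 A g))) ∧
        (gradedCapelli F .evenSym qp ⊆ (UT.str A g).identities ↔
          qp > UT.dim A .evenSym + (m - UT.numTrivial A) + (UT.numStrings A - 1) + UT.r0 A g) ∧
        (gradedCapelli F .evenSkew qm ⊆ (UT.str A g).identities →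
          qm > UT.dim A .evenSkew + (m - UT.numTrivial A) + (UT.numStrings A - 1) + UT.r0 A g) ∧
        (gradedCapelli F .oddSym kp ⊆ (UT.str A g).identities ↔
          kp > UT.dim A .oddSym + (m - UT.numTrivial A) + (UT.numStrings A - 1) + UT.r1 A g) ∧
        (gradedCapelli F .oddSkew km ⊆ (UT.str A g).identities ↔
          km > UT.dim A .oddSkew + (m - UT.numTrivial A) + (UT.numStrings A - 1)
            + UT.r1 A g)) := by

  have hl0 := UT.numLinks_zero_add_r1 A g
  have hl1 := UT.numLinks_one_add_r0 A g
  have hr := UT.r0_add_r1_add_numStrings A g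
  constructor
  · intro h0 qp qm kp km hqp hqm hkp hkm
    have hiso := UT.not_isolated_of_numTrivial_eq_zero g h0
    -- The lower bound needs at least one block. For `m = 0` dimensions and links vanish, so both
    -- sides hold for all positive ranks.
    rcases Nat.eq_zero_or_pos m with rfl | hm
    · have hd : ∀ κ, UT.dim A κ = 0 := fun κ => Finset.sum_of_isEmpty _
      have hid : ∀ κ n, 0 < n → gradedCapelli F κ n ⊆ (UT.str A g).identities := by
        intro κ n hn
        refine UT.gradedCapelli_subset_identities (fun _ => hiso) ?_
        rcases zmod_two_eq_zero_or_one κ.deg with h | h <;> rw [h, hd] <;> omega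
      simp only [hd, hid _ _ hqp, hid _ _ hqm, hid _ _ hkp, hid _ _ hkm]
      simp
    · rw [UT.gradedCapelli_subset_identities_iff hm (fun _ => hiso) hqp,
        UT.gradedCapelli_subset_identities_iff hm (fun _ => hiso) hqm,
        UT.gradedCapelli_subset_identities_iff hm (fun _ => hiso) hkp,
        UT.gradedCapelli_subset_identities_iff hm (fun _ => hiso) hkm]
      -- Without trivially graded blocks `r₀ = r₁ = 0`, so there are `m - 1` links in each degree
      -- and `d + (m - 1) < n` reads `n ≥ d + m`.
      simp only [VarKind.deg]
      omega
  · intro hpos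
    have hS := UT.numStrings_pos hpos
    have hT := UT.numTrivial_le A
    have hm : 0 < m := by omega
    refine ⟨by omega, fun qp qm kp km hqp hqm hkp hkm => ?_⟩
    -- The string number is positive and `m̄ ≤ m`, so no subtraction is truncated and `m - 1 - r₁ =
    -- (m - m̄) + (m̃ - 1) + r₀`; symmetrically in degree 1.
    have e0 : UT.numLinks A g 0 =
        (m - UT.numTrivial A) + (UT.numStrings A - 1) + UT.r0 A g := by omega
    have e1 : UT.numLinks A g 1 =
        (m - UT.numTrivial A) + (UT.numStrings A - 1) + UT.r1 A g := by omega
    have hqp' := UT.gradedCapelli_subset_identities_iff (A := A) (g := g) (κ := .evenSym) hm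
      nofun hqp
    have hkp' := UT.gradedCapelli_subset_identities_iff (A := A) (g := g) (κ := .oddSym) hm
      nofun hkp
    have hkm' := UT.gradedCapelli_subset_identities_iff (A := A) (g := g) (κ := .oddSkew) hm
      nofun hkm
    simp only [VarKind.deg, e0, e1, ← add_assoc] at hqp' hkp' hkm'
    refine ⟨fun hiso => ?_, hqp', fun h => ?_, hkp', hkm'⟩
    · have hqm' := UT.gradedCapelli_subset_identities_iff (A := A) (g := g) (κ := .evenSkew) hm
        (fun _ => hiso) hqm
      simp only [VarKind.deg, e0, ← add_assoc] at hqm'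
      rw [hqp', hqm', hkp', hkm']
    · have := UT.lt_of_gradedCapelli_subset_identities hm hqm h
      simp only [VarKind.deg, e0, ← add_assoc] at this
      exact this
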